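/- Let $P>0$ and let $$y(t)=\sum_{j=1}^{M}\Big(\sum_{m=0}^{n_j}\gamma_{j,m}t^m\Big)e^{2\pi\lambda_j t},\qquad n_j\in\mathbb N_0,\ \gamma_{j,m}\in\mathbb C,\ \gamma_{j,n_j}\ne 0,\ \lambda_j\in\mathbb C\ \text{pairwise distinct},$$ be an extended exponential sum of order $N=\sum_{j=1}^M(1+n_j)$, with Fourier coefficients $c_k(y)=\frac1P\int_0^P y(t)e^{-2\pi i kt/P}\,dt$. Call the $j$-th term $P$-periodic if $-i\lambda_jP\in\mathbb Z$, write $y=y^{(1)}+y^{(2)}$, where $y^{(2)}$ is the sum of the $P$-periodic terms, let $M_2\ge 1$ be the number of these terms and $\Sigma=\{-i\lambda_jP\}\cap\mathbb Z$ the set of the corresponding integers. Let $\Gamma\subset\mathbb Z$ be finite with $\Sigma\subset\Gamma$ and $L=|\Gamma|\ge 2N+2$. The modified AAA algorithm, applied to the points $k\in\Gamma$ with data $f(k)=c_k(y)$, a tolerance $tol>0$ and a maximal number $jmax$ of steps, is the following procedure in exact arithmetic. In step $j=1$, $S\subset\Gamma$ consists of two points where $|f|$ is largest; in step $j>1$,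 a point of $\Gamma\setminus S$ with maximal error in the previous step is added to $S$. In step $j$ (where $|S|=j+1$) form the Loewner matrix $A=\big(\frac{f(z)-f(k)}{z-k}\big)_{z\in\Gamma\setminus S,\,k\in S}$, take orthonormal right singular vectors $v_1,v_2\in\mathbb C^{S}$ of $A$ for its two smallest singular values (the smallest for $v_1$; kernel vectors count as right singular vectors for $0$), and let $w$ be the normalization of $(v_2^{T}f_S)v_1-(v_1^{T}f_S)v_2$, or $w=v_1$ if this vector is zero. Put $p(z)=\sum_{k\in S}\frac{w_kf(k)}{z-k}$, $q(z)=\sum_{k\in S}\frac{w_k}{z-k}$ and $r=p/q$. The error at $z\in\Gamma\setminus S$ is $|p(z)/q(z)-f(z)|$ if $q(z)\neq0$, and $\infty$ if $q(z)=0\ne p(z)$; points with $p(z)=q(z)=0$ do not contribute. The algorithm stops if the maximal error over $\Gamma\setminus S$ is less than $tol$, and otherwise goes on to step $j+1$ as long as $j+1\le jmax$. Ties and the choice of singular vectors are arbitrary. Then: 1. $y$ is uniquely recovered from $\{c_k(y):k\in\Gamma\}$: if $y'$ is any extended exponential sum of this form, of order $N'$ with $L\ge 2N'+2$, whose set of integers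 $\Sigma'$ satisfies $\Sigma'\subset\Gamma$, and if $c_k(y')=c_k(y)$ for all $k\in\Gamma$, then $y'$ and $y$ have the same parameters $M$, $n_j$, $\lambda_j$, $\gamma_{j,m}$ up to a permutation of the terms. 2. There is $tol_0>0$ (depending on $y,P,\Gamma$) such that for all $0<tol\le tol_0$ and all $jmax\ge N+1$ every run of the modified AAA algorithm can be carried out and meets the stopping test after at most $N+1$ steps, and the resulting rational function $r^{\dagger}_{N-M_2}=p/q$ is of type $(N-M_2-1,N-M_2)$, that is, in lowest terms its numerator has degree at most $N-M_2-1$ (it is $0$ if $N=M_2$) and its denominator has degree exactly $N-M_2$; it has no pole in $\mathbb Z\setminus\Sigma$, and $c_k(y)=r^{\dagger}_{N-M_2}(k)$ for all $k\in\mathbb Z\setminus\Sigma$. -/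

import Mathlib

open scoped Matrix ENNReal

noncomputable section

/-! ## Extended exponential sums and their Fourier coefficients -/

/-- The parameters of an extended exponential sum
`y(t) = ∑_{j < M} (∑_{m ≤ n j} γ j m * t ^ m) * exp (2 π λ_j t)` with pairwise distinct
frequencies `λ_j = lam j` and leading coefficients `γ j (n j) ≠ 0`.
The values `γ j m` with `m > n j` are not used. -/
structure ExtExpSum where
  M : ℕ
  n : Fin M → ℕ
  γ : Fin M → ℕ → ℂ
  lam : Fin M → ℂ
  leading_ne_zero : ∀ j, γ j (n j) ≠ 0
  lam_injective : Function.Injective lam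

namespace ExtExpSum

/-- The function `y : ℝ → ℂ` itself. -/
def toFun (y : ExtExpSum) (t : ℝ) : ℂ :=
  ∑ j, (∑ m ∈ Finset.range (y.n j + 1), y.γ j m * (t : ℂ) ^ m) *
    Complex.exp (2 * Real.pi * y.lam j * t)

/-- The order `N = ∑_j (1 + n_j)`. -/
def order (y : ExtExpSum) : ℕ := ∑ j, (1 + y.n j)

/-- The `j`-th term is `P`-periodic: `-i λ_j P` is an integer. (As in common usage, this concerns
the exponential factor of the term.) -/
def IsPeriodicTerm (y : ExtExpSum) (P : ℝ) (j : Fin y.M) : Prop :=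
  ∃ k : ℤ, -Complex.I * y.lam j * P = k

open Classical in
/-- The number `M₂` of terms of the `P`-periodic part `y⁽²⁾`. -/
def numPeriodic (y : ExtExpSum) (P : ℝ) : ℕ :=
  (Finset.univ.filter fun j => y.IsPeriodicTerm P j).card

/-- The index set `Σ = {-i λ_j P : the j-th term is P-periodic} ⊂ ℤ`. -/
def periodicSet (y : ExtExpSum) (P : ℝ) : Set ℤ :=
  {k | ∃ j, -Complex.I * y.lam j * P = k}

/-- The Fourier coefficient `c_k(y) = (1/P) ∫_0^P y(t) exp (-2 π i k t / P) dt`. -/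
def fourierCoef (y : ExtExpSum) (P : ℝ) (k : ℤ) : ℂ :=
  (1 / (P : ℂ)) * ∫ t in (0 : ℝ)..P,
    y.toFun t * Complex.exp (-2 * Real.pi * Complex.I * k * t / P)

/-- Both sums have the same parameters, up to a permutation of the terms. -/
def SameParameters (y y' : ExtExpSum) : Prop :=
  ∃ e : Fin y.M ≃ Fin y'.M, ∀ j, y'.lam (e j) = y.lam j ∧ y'.n (e j) = y.n j ∧
    ∀ m ≤ y.n j, y'.γ (e j) m = y.γ j m

end ExtExpSum

/-! ## The modified AAA algorithm (in exact arithmetic)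

The support points are `x i`, `i ∈ Γ`, with data `f i`. The state after step `j` consists of the set
`S ⊆ Γ` of the (indices of the) `j + 1` points chosen for interpolation and the weight vector
`w ∈ ℂ^S`. Ties and the choice of singular vectors are left open: the predicates below describe
all possible runs. -/

/-- Input of the algorithm: points, data, index set, tolerance, maximal number of steps. -/
structure AAAInput (ι : Type*) where
  x : ι → ℂ
  f : ι → ℂ
  Γ : Finset ι
  tol : ℝ
  jmax : ℕ

namespace AAAInput

variable {ι : Type*} [DecidableEq ι] (I : AAAInput ι)

/-- The Loewner matrix `((f z - f k) / (z - k))` with rows `z ∈ Γ \ S` and columns `k ∈ S`. -/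
def loewner (S : Finset ι) : Matrix ↥(I.Γ \ S) ↥S ℂ :=
  Matrix.of fun z k => (I.f z - I.f k) / (I.x z - I.x k)

/-- The bilinear product `vᵀ f_S` (no complex conjugation). -/
def dotData (S : Finset ι) (v : EuclideanSpace ℂ ↥S) : ℂ := ∑ k : ↥S, v k * I.f k

/-- `V` is a full orthonormal system of right singular vectors of `A`, with singular values `σ` in
increasing order. (The kernel is included, with singular value `0`, also when `A` has fewer rows
than columns.) -/
def IsRightSingularSystem {m : Type*} [Fintype m] {S : Finset ι} (A : Matrix m ↥S ℂ)
    (V : OrthonormalBasis (Fin S.card) ℂ (EuclideanSpace ℂ ↥S)) (σ : Fin S.card → ℝ) : Prop :=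
  Monotone σ ∧ (∀ i, 0 ≤ σ i) ∧
    ∀ i, (Aᴴ * A) *ᵥ (V i).ofLp = ((σ i : ℂ) ^ 2) • (V i).ofLp

/-- `w` is a weight vector that the algorithm may compute for the support set `S`: with right singular
vectors `v₁, v₂` for the two smallest singular values of the Loewner matrix, it is the normalization
of `(v₂ᵀ f_S) v₁ - (v₁ᵀ f_S) v₂`, and it is `v₁` if this combination is zero, that is, if
`v₁` and `v₂` both already satisfy the side condition `vᵀ f_S = 0`. -/
def IsWeight (S : Finset ι) (w : EuclideanSpace ℂ ↥S) : Prop :=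
  ∃ (V : OrthonormalBasis (Fin S.card) ℂ (EuclideanSpace ℂ ↥S)) (σ : Fin S.card → ℝ)
    (i₁ i₂ : Fin S.card),
    IsRightSingularSystem (I.loewner S) V σ ∧ (i₁ : ℕ) = 0 ∧ (i₂ : ℕ) = 1 ∧
    ∃ w₀ : EuclideanSpace ℂ ↥S,
      w₀ = I.dotData S (V i₂) • V i₁ - I.dotData S (V i₁) • V i₂ ∧
      (w₀ ≠ 0 → w = ((‖w₀‖⁻¹ : ℝ) : ℂ) • w₀) ∧ (w₀ = 0 → w = V i₁)

/-- The value `p(z) = ∑_{k ∈ S} w_k f_k / (z - k)`. -/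
def numVal (S : Finset ι) (w : EuclideanSpace ℂ ↥S) (z : ι) : ℂ :=
  ∑ k : ↥S, w k * I.f k / (I.x z - I.x k)

/-- The value `q(z) = ∑_{k ∈ S} w_k / (z - k)`. -/
def denVal (S : Finset ι) (w : EuclideanSpace ℂ ↥S) (z : ι) : ℂ :=
  ∑ k : ↥S, w k / (I.x z - I.x k)

open Classical in
/-- The error `|p(z)/q(z) - f(z)|` at a point not chosen for interpolation. It is `∞` if only the
denominator vanishes; points with `p(z) = q(z) = 0`, where the quotient is undefined and the
linearized equation `f(z) q(z) = p(z)` holds, do not contribute to the error. -/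
def error (S : Finset ι) (w : EuclideanSpace ℂ ↥S) (z : ι) : ℝ≥0∞ :=
  if I.denVal S w z ≠ 0 then ENNReal.ofReal ‖I.numVal S w z / I.denVal S w z - I.f z‖
  else if I.numVal S w z = 0 then 0 else ⊤

/-- The stopping test: the maximal error over `Γ \ S` is smaller than the tolerance. -/
def Stops (S : Finset ι) (w : EuclideanSpace ℂ ↥S) : Prop :=
  ∀ z ∈ I.Γ \ S, I.error S w z < ENNReal.ofReal I.tol

/-- `I.Reaches j S w`: some run of the algorithm performs step `j`, and in this step arrives at the
support set `S` and the weight vector `w`. -/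
inductive Reaches : ℕ → (S : Finset ι) → EuclideanSpace ℂ ↥S → Prop
  /-- Step 1 starts with two points with largest absolute data values. -/
  | start (z₁ z₂ : ι) (w : EuclideanSpace ℂ ↥({z₁, z₂} : Finset ι))
      (hjmax : 1 ≤ I.jmax) (h₁ : z₁ ∈ I.Γ) (h₂ : z₂ ∈ I.Γ) (hne : z₁ ≠ z₂)
      (hmax : ∀ z ∈ I.Γ \ {z₁, z₂}, ‖I.f z‖ ≤ ‖I.f z₁‖ ∧ ‖I.f z‖ ≤ ‖I.f z₂‖)
      (hw : I.IsWeight {z₁, z₂} w) : Reaches 1 {z₁, z₂} w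
  /-- If the test fails, the next step adds a point with maximal error. -/
  | next (j : ℕ) (S : Finset ι) (w : EuclideanSpace ℂ ↥S) (z : ι)
      (w' : EuclideanSpace ℂ ↥(insert z S))
      (h : Reaches j S w) (hfail : ¬ I.Stops S w) (hjmax : j + 1 ≤ I.jmax)
      (hz : z ∈ I.Γ \ S) (hmax : ∀ z' ∈ I.Γ \ S, I.error S w z' ≤ I.error S w z)
      (hw : I.IsWeight (insert z S) w') : Reaches (j + 1) (insert z S) w'

/-- The run that has arrived at `S`, `w` in step `j` can perform another step. -/
def CanContinue (j : ℕ) (S : Finset ι) (w : EuclideanSpace ℂ ↥S) : Prop :=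
  ¬ I.Stops S w ∧ j + 1 ≤ I.jmax ∧ ∃ z ∈ I.Γ \ S,
    (∀ z' ∈ I.Γ \ S, I.error S w z' ≤ I.error S w z) ∧ ∃ w', I.IsWeight (insert z S) w'

/-- The rational function in barycentric form determined by `S` and `w`. -/
def ratFunc (S : Finset ι) (w : EuclideanSpace ℂ ↥S) : RatFunc ℂ :=
  (∑ k : ↥S, RatFunc.C (w k * I.f k) / (RatFunc.X - RatFunc.C (I.x k))) /
    (∑ k : ↥S, RatFunc.C (w k) / (RatFunc.X - RatFunc.C (I.x k)))

end AAAInput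

/-- `r = p / q` in lowest terms is of type `(d - 1, d)`: `deg p ≤ d - 1` (so `p = 0` if `d = 0`) and
`deg q = d`. -/
def IsOfType (r : RatFunc ℂ) (d : ℕ) : Prop :=
  r.num.degree < (d : WithBot ℕ) ∧ r.denom.natDegree = d

/-- The input of the algorithm made of the Fourier coefficients `c_k(y)`, `k ∈ Γ`. -/
def fourierInput (y : ExtExpSum) (P : ℝ) (Γ : Finset ℤ) (tol : ℝ) (jmax : ℕ) : AAAInput ℤ where
  x := fun k => (k : ℂ)
  f := y.fourierCoef P
  Γ := Γ
  tol := tol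
  jmax := jmax

end

noncomputable section

open Polynomial

/-! ## Fourier coefficients of exponential sums as values of a rational function -/

/-! Write `a_j = -i λ_j P`. Integration by parts makes the Fourier coefficients of the `j`-th term a
rational function of `k` whose only possible pole is `a_j`. Its order is `n_j + 1`, except when
`a_j` is an integer: then the boundary exponential is `1`, the leading boundary term cancels and the
order drops to `n_j`. Summing gives coprime `p`, `q` with `deg p < deg q = N - M₂` and `p(k) = c_k
q(k)` for integers `k ∉ Σ`. The equation fails at every `k ∈ Σ` (`exists_rational_fourierCoef`).
With `s = ∏_{k ∈ Σ} (X - k)`, the pair `(ps, qs)` satisfies it at all integers and has denominator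
degree `N`.

Since `|Γ| > 2N`, cross-multiplication shows that a pair of degree at most `N` satisfying the
equation on `Γ` has the form `(ph, qh)`. The failure on `Σ ⊆ Γ` forces `s ∣ h`, so `(ps, qs)` is a
minimal solution (`isMinimalSolution`).

Kernel vectors of the Loewner matrix correspond to barycentric solutions of degree at most `|S| -
1`. Hence the kernel is trivial for `|S| ≤ N`; for `|S| = N + 1` it is nonzero and yields only
scalar multiples of `(ps, qs)`. There `deg (ps) < N` makes the side condition `vᵀ f_S = 0`
automatic, so the computed weight is a kernel vector, all errors are `0`, and the quotient reduces
to `p / q`. For smaller `S`, injectivity bounds the residual below relative to the denominator; as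
`Γ` has finitely many subsets, one tolerance excludes every early stop (`exists_pos_not_stops`).

For uniqueness, cross-multiplying the pairs of `y` and `y'` shows that all their Fourier
coefficients agree. Completeness of the Fourier basis gives equality on `(0, P)`, and linear
independence of exponential polynomials gives equal parameters. -/

theorem integral_eval_mul_exp (P : ℝ) {μ : ℂ} (hμ : μ ≠ 0) (n : ℕ) (g : ℂ[X])
    (hg : g.natDegree ≤ n) :
    ∫ t in (0 : ℝ)..P, g.eval (t : ℂ) * Complex.exp (μ * t) =
      ∑ m ∈ Finset.range (n + 1), (-1) ^ m *
        ((derivative^[m] g).eval (P : ℂ) * Complex.exp (μ * P) - (derivative^[m] g).eval 0) /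
          μ ^ (m + 1) := by
  have hd : ∀ (g : ℂ[X]) (t : ℝ), HasDerivAt
      (fun t : ℝ => g.eval (t : ℂ) * Complex.exp (μ * t) / μ)
      ((derivative g).eval (t : ℂ) * Complex.exp (μ * t) / μ
        + g.eval (t : ℂ) * Complex.exp (μ * t)) t := by
    intro g t
    have h1 : HasDerivAt (fun z : ℂ => g.eval z * Complex.exp (μ * z) / μ)
        (((derivative g).eval (t : ℂ) * Complex.exp (μ * t)
          + g.eval (t : ℂ) * (Complex.exp (μ * t) * (μ * 1))) / μ) (t : ℂ) :=
      ((g.hasDerivAt (t : ℂ)).mul (((hasDerivAt_id (t : ℂ)).const_mul μ).cexp)).div_const μ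
    have h2 := h1.comp_ofReal
    convert h2 using 1
    field_simp
  have hc : ∀ g : ℂ[X], Continuous fun t : ℝ => g.eval (t : ℂ) * Complex.exp (μ * t) := by
    intro g
    have := g.continuous
    fun_prop
  have hparts : ∀ g : ℂ[X], ∫ t in (0 : ℝ)..P, g.eval (t : ℂ) * Complex.exp (μ * t) =
      (g.eval (P : ℂ) * Complex.exp (μ * P) - g.eval 0) / μ
        - (∫ t in (0 : ℝ)..P, (derivative g).eval (t : ℂ) * Complex.exp (μ * t)) / μ := by
    intro g
    have h := intervalIntegral.integral_eq_sub_of_hasDerivAt (a := 0) (b := P)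
      (fun t _ => hd g t)
      ((((hc (derivative g)).div_const μ).add (hc g)).intervalIntegrable 0 P)
    rw [intervalIntegral.integral_add (((hc (derivative g)).div_const μ).intervalIntegrable 0 P)
      ((hc g).intervalIntegrable 0 P), intervalIntegral.integral_div] at h
    simp only [Complex.ofReal_zero, mul_zero, Complex.exp_zero, mul_one] at h
    rw [eq_sub_iff_add_eq, add_comm, h, sub_div]
  induction n generalizing g with
  | zero =>
    rw [hparts g, derivative_of_natDegree_zero (by omega)]
    simp
  | succ n ih =>
    rw [hparts g, ih (derivative g) ((natDegree_derivative_le g).trans (by omega)),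
      Finset.sum_range_succ' _ (n + 1), Finset.sum_div, sub_eq_add_neg, ← Finset.sum_neg_distrib,
      add_comm]
    congr 1
    · refine Finset.sum_congr rfl fun m _ => ?_
      rw [Function.iterate_succ_apply]
      field_simp
      ring
    · simp

/-- The `k`-th Fourier coefficient of `g(t) * exp (2 π λ t)` on `[0, P]`. -/
def expPolyCoef (P : ℝ) (g : ℂ[X]) (lam : ℂ) (k : ℤ) : ℂ :=
  (1 / (P : ℂ)) * ∫ t in (0 : ℝ)..P,
    g.eval (t : ℂ) * Complex.exp (2 * Real.pi * lam * t) *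
      Complex.exp (-2 * Real.pi * Complex.I * k * t / P)

theorem expPolyCoef_eq (P : ℝ) (hP : P ≠ 0) (g : ℂ[X]) (lam : ℂ) (k : ℤ) :
    expPolyCoef P g lam k = (1 / (P : ℂ)) * ∫ t in (0 : ℝ)..P, g.eval (t : ℂ) *
      Complex.exp ((-(2 * Real.pi * Complex.I / P) * (k - -Complex.I * lam * P)) * t) := by
  unfold expPolyCoef
  congr 1
  refine intervalIntegral.integral_congr fun t _ => ?_
  have hP' : (P : ℂ) ≠ 0 := by exact_mod_cast hP
  rw [mul_assoc, ← Complex.exp_add]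
  congr 2
  field_simp
  linear_combination (t * lam * P : ℂ) * Complex.I_sq

theorem iterate_derivative_eval_natDegree (g : ℂ[X]) (z : ℂ) :
    (derivative^[g.natDegree] g).eval z = (g.natDegree.factorial : ℂ) * g.leadingCoeff := by
  have h0 : (derivative^[g.natDegree] g).natDegree ≤ 0 :=
    (natDegree_iterate_derivative g _).trans (by omega)
  rw [eq_C_of_natDegree_le_zero h0, eval_C, coeff_iterate_derivative]
  simp [Nat.descFactorial_self]

theorem iterate_derivative_eval_sub (g : ℂ[X]) (n : ℕ) (hn : g.natDegree = n + 1) (z : ℂ) :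
    (derivative^[n] g).eval z - (derivative^[n] g).eval 0 =
      ((n + 1).factorial : ℂ) * g.leadingCoeff * z := by
  have h0 : (derivative^[n] g).natDegree ≤ 1 :=
    (natDegree_iterate_derivative g _).trans (by omega)
  rw [eq_X_add_C_of_natDegree_le_one h0]
  simp only [coeff_iterate_derivative, eval_add, eval_mul, eval_C, eval_X, leadingCoeff, hn]
  rw [show (1 + n).descFactorial n = (n + 1).factorial by
    simpa [add_comm] using Nat.factorial_mul_descFactorial (Nat.le_succ n)]
  simp [add_comm 1 n]

/-- Outside the point `a = -i λ P`, the Fourier coefficients of an exponential polynomial are the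
values of a rational function whose only pole `a` has order `deg g + 1`, or `deg g` in the periodic case. -/
theorem exists_expPolyCoef_mul_pow (P : ℝ) (hP : P ≠ 0) (g : ℂ[X]) (hg : g ≠ 0) (lam : ℂ) (e : ℕ)
    (hper : (∃ k : ℤ, -Complex.I * lam * P = k) → e = g.natDegree)
    (hnon : (¬ ∃ k : ℤ, -Complex.I * lam * P = k) → e = g.natDegree + 1) :
    ∃ u : ℂ[X], u.degree < e ∧ (e ≠ 0 → u.eval (-Complex.I * lam * P) ≠ 0) ∧
      ∀ k : ℤ, (k : ℂ) ≠ -Complex.I * lam * P →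
        expPolyCoef P g lam k * ((k : ℂ) - -Complex.I * lam * P) ^ e = u.eval (k : ℂ) := by
  set a : ℂ := -Complex.I * lam * P with ha
  have hP' : (P : ℂ) ≠ 0 := by exact_mod_cast hP
  have hpi : (Real.pi : ℂ) ≠ 0 := by exact_mod_cast Real.pi_ne_zero
  set c : ℂ := -(2 * Real.pi * Complex.I / P) with hc
  have hc0 : c ≠ 0 := by
    rw [hc]
    simp [hpi, hP']
  set E : ℂ := Complex.exp (2 * Real.pi * Complex.I * a) with hE
  have hE1 : E = 1 ↔ ∃ k : ℤ, a = k := by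
    rw [hE, Complex.exp_eq_one_iff]
    refine exists_congr fun k => ?_
    have h2 : (2 * Real.pi * Complex.I : ℂ) ≠ 0 := by simp [hpi]
    rw [mul_comm (k : ℂ), mul_right_inj' h2]
  -- The boundary factor at `P` is the same number `E` for every integer `k`, so these numerators do
  -- not depend on `k`.
  set b : ℕ → ℂ := fun m =>
    (-1) ^ m * ((derivative^[m] g).eval (P : ℂ) * E - (derivative^[m] g).eval 0) with hb
  have hEk : ∀ k : ℤ, Complex.exp (c * (k - a) * P) = E := by
    intro k
    rw [hE, Complex.exp_eq_exp_iff_exists_int]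
    refine ⟨-k, ?_⟩
    rw [hc]
    push_cast
    field_simp
    ring
  have hlc : g.leadingCoeff ≠ 0 := leadingCoeff_ne_zero.mpr hg
  have hcoef : ∀ k : ℤ, (k : ℂ) ≠ a → expPolyCoef P g lam k =
      (1 / (P : ℂ)) * ∑ m ∈ Finset.range e, b m / (c * (k - a)) ^ (m + 1) := by
    intro k hk
    have hμ : c * ((k : ℂ) - a) ≠ 0 := mul_ne_zero hc0 (sub_ne_zero.mpr hk)
    rw [expPolyCoef_eq P hP, integral_eval_mul_exp P hμ g.natDegree g le_rfl, hEk]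
    congr 1
    by_cases h : ∃ k : ℤ, a = k
    · rw [hper h, Finset.sum_range_succ]
      -- The derivative of order `deg g` is constant and `E = 1`, so the two boundary values cancel.
      have : b g.natDegree = 0 := by
        rw [hb, hE1.mpr h]
        simp only [iterate_derivative_eval_natDegree]
        ring
      rw [show (-1) ^ g.natDegree * (eval (↑P) (derivative^[g.natDegree] g) * E -
        eval 0 (derivative^[g.natDegree] g)) = b g.natDegree from rfl, this, zero_div, add_zero]
    · rw [hnon h]
  -- The coefficient of the highest power of the pole survives. In the periodic case it is the
  -- increment over `[0, P]` of a nonconstant linear polynomial; otherwise it is a nonzero constant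
  -- times `E - 1`.
  have hbe : ∀ d, e = d + 1 → b d ≠ 0 := by
    intro d hd
    have h1 : ((-1 : ℂ)) ^ d ≠ 0 := pow_ne_zero _ (by norm_num)
    refine mul_ne_zero h1 ?_
    by_cases h : ∃ k : ℤ, a = k
    · rw [hE1.mpr h, mul_one, iterate_derivative_eval_sub g d (by rw [← hper h, hd])]
      exact mul_ne_zero (mul_ne_zero (by exact_mod_cast (Nat.factorial_ne_zero _)) hlc) hP'
    · have hd' : d = g.natDegree := by have := hnon h; omega
      rw [hd', iterate_derivative_eval_natDegree, iterate_derivative_eval_natDegree,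
        ← mul_sub_one]
      refine mul_ne_zero (mul_ne_zero (by exact_mod_cast (Nat.factorial_ne_zero _)) hlc) ?_
      exact sub_ne_zero.mpr fun h' => h (hE1.mp h')
  refine ⟨∑ m ∈ Finset.range e, C (b m / (P * c ^ (m + 1))) * (X - C a) ^ (e - 1 - m), ?_, ?_, ?_⟩
  · rw [← mem_degreeLT]
    refine Submodule.sum_mem _ fun m hm => ?_
    rw [← smul_eq_C_mul]
    refine Submodule.smul_mem _ _ ?_
    rw [mem_degreeLT, degree_pow, degree_X_sub_C, nsmul_one]
    have := Finset.mem_range.mp hm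
    exact_mod_cast (by omega : e - 1 - m < e)
  · intro he
    obtain ⟨d, rfl⟩ := Nat.exists_eq_succ_of_ne_zero he
    rw [eval_finsetSum, Finset.sum_range_succ, Finset.sum_eq_zero]
    · simpa [hP', hc0] using hbe d rfl
    · intro m hm
      have := Finset.mem_range.mp hm
      simp only [eval_mul, eval_C, eval_pow, eval_sub, eval_X, sub_self]
      rw [zero_pow (by omega), mul_zero]
  · intro k hk
    have hk' : (k : ℂ) - a ≠ 0 := sub_ne_zero.mpr hk
    rw [hcoef k hk, eval_finsetSum, Finset.mul_sum, Finset.sum_mul]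
    refine Finset.sum_congr rfl fun m hm => ?_
    have hm' := Finset.mem_range.mp hm
    simp only [eval_mul, eval_C, eval_pow, eval_sub, eval_X]
    obtain ⟨d, rfl⟩ : ∃ d, e = d + (m + 1) := ⟨e - (m + 1), by omega⟩
    rw [show d + (m + 1) - 1 - m = d by omega, mul_pow, pow_add]
    field_simp
    ring

/-- A periodic term with constant coefficient has no pole. This nonzero value at its own frequency
is what makes the rational formula fail there. -/
theorem expPolyCoef_ne_zero (P : ℝ) (hP : P ≠ 0) (g : ℂ[X]) (hg : g ≠ 0) (hdeg : g.natDegree = 0)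
    (lam : ℂ) (k : ℤ) (hk : -Complex.I * lam * P = k) : expPolyCoef P g lam k ≠ 0 := by
  have hP' : (P : ℂ) ≠ 0 := by exact_mod_cast hP
  rw [expPolyCoef_eq P hP, hk, eq_C_of_natDegree_eq_zero hdeg]
  have : g.coeff 0 ≠ 0 := fun h => hg (by rw [eq_C_of_natDegree_eq_zero hdeg, h, C_0])
  simpa [hP'] using this

/-! ### Sums of partial fractions over a common denominator -/

section PartialFractions

variable {ι : Type*} [Fintype ι] (a : ι → ℂ) (e : ι → ℕ) (u : ι → ℂ[X])

/-- The common denominator of the fractions `u j / (X - a j) ^ e j`. -/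
def fracDen : ℂ[X] := ∏ j, (X - C (a j)) ^ e j

theorem fracDen_monic : (fracDen a e).Monic :=
  monic_prod_of_monic _ _ fun j _ => (monic_X_sub_C (a j)).pow (e j)

theorem natDegree_fracDen : (fracDen a e).natDegree = ∑ j, e j := by
  rw [fracDen, natDegree_prod_of_monic _ _ fun j _ => (monic_X_sub_C (a j)).pow (e j)]
  simp

variable {a e}

theorem eval_fracDen_ne_zero {z : ℂ} (h : ∀ j, e j ≠ 0 → z ≠ a j) :
    (fracDen a e).eval z ≠ 0 := by
  rw [fracDen, eval_prod]
  refine Finset.prod_ne_zero_iff.mpr fun j _ => ?_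
  rw [eval_pow, eval_sub, eval_X, eval_C]
  by_cases hj : e j = 0
  · simp [hj]
  · exact pow_ne_zero _ (sub_ne_zero.mpr (h j hj))

theorem eval_fracDen_of_pole {i : ι} (hi : e i ≠ 0) : (fracDen a e).eval (a i) = 0 := by
  rw [fracDen, eval_prod, Finset.prod_eq_zero (Finset.mem_univ i)]
  simp [hi]

variable (a e) [DecidableEq ι]

/-- The numerator of the sum of the fractions `u j / (X - a j) ^ e j`. -/
def fracNum : ℂ[X] := ∑ j, u j * ∏ i ∈ Finset.univ.erase j, (X - C (a i)) ^ e i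

variable {a e u}

theorem degree_fracNum_lt (hu : ∀ j, (u j).degree < e j) :
    (fracNum a e u).degree < ((∑ j, e j : ℕ) : WithBot ℕ) := by
  rw [← mem_degreeLT]
  refine Submodule.sum_mem _ fun j _ => ?_
  rw [mem_degreeLT]
  rcases eq_or_ne (u j) 0 with h0 | h0
  · rw [h0, zero_mul, degree_zero]
    exact WithBot.bot_lt_coe _
  have hm : (∏ i ∈ Finset.univ.erase j, (X - C (a i)) ^ e i).Monic :=
    monic_prod_of_monic _ _ fun i _ => (monic_X_sub_C (a i)).pow (e i)
  have hd : (∏ i ∈ Finset.univ.erase j, (X - C (a i)) ^ e i).natDegree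
      = ∑ i ∈ Finset.univ.erase j, e i := by
    rw [natDegree_prod_of_monic _ _ fun i _ => (monic_X_sub_C (a i)).pow (e i)]
    simp
  rw [degree_mul, degree_eq_natDegree h0, degree_eq_natDegree hm.ne_zero, hd]
  have h1 := hu j
  rw [degree_eq_natDegree h0] at h1
  have h2 : (u j).natDegree < e j := by exact_mod_cast h1
  have h3 := Finset.add_sum_erase Finset.univ e (Finset.mem_univ j)
  exact_mod_cast (by omega : (u j).natDegree + ∑ i ∈ Finset.univ.erase j, e i < ∑ i, e i)

theorem eval_fracNum_of_pole (ha : Function.Injective a) {i : ι} (hi : e i ≠ 0)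
    (hu : (u i).eval (a i) ≠ 0) : (fracNum a e u).eval (a i) ≠ 0 := by
  rw [fracNum, eval_finsetSum, Finset.sum_eq_single i]
  · rw [eval_mul, eval_prod]
    refine mul_ne_zero hu (Finset.prod_ne_zero_iff.mpr fun j hj => ?_)
    rw [eval_pow, eval_sub, eval_X, eval_C]
    exact pow_ne_zero _ (sub_ne_zero.mpr fun h => (Finset.mem_erase.mp hj).1 (ha h).symm)
  · intro j _ hj
    rw [eval_mul, eval_prod, Finset.prod_eq_zero (Finset.mem_erase.mpr ⟨hj.symm, Finset.mem_univ i⟩),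
      mul_zero]
    simp [hi]
  · simp

theorem isCoprime_fracNum_fracDen (ha : Function.Injective a)
    (hu : ∀ j, e j ≠ 0 → (u j).eval (a j) ≠ 0) :
    IsCoprime (fracNum a e u) (fracDen a e) := by
  refine IsCoprime.prod_right fun j _ => ?_
  by_cases hj : e j = 0
  · rw [hj, pow_zero]
    exact isCoprime_one_right
  refine IsCoprime.pow_right (IsCoprime.symm ?_)
  rw [(irreducible_X_sub_C (a j)).coprime_iff_not_dvd, dvd_iff_isRoot]
  exact eval_fracNum_of_pole ha hj (hu j hj)

/-- Multiplied-out identities replace quotients, so `z` may be a point `a j` with `e j = 0`. -/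
theorem sum_mul_eval_fracDen {z : ℂ} (τ : ι → ℂ) (h : ∀ j, τ j * (z - a j) ^ e j = (u j).eval z) :
    (∑ j, τ j) * (fracDen a e).eval z = (fracNum a e u).eval z := by
  rw [fracNum, eval_finsetSum, Finset.sum_mul]
  refine Finset.sum_congr rfl fun j _ => ?_
  rw [fracDen, ← Finset.mul_prod_erase Finset.univ _ (Finset.mem_univ j), eval_mul, eval_mul, ← h j,
    eval_pow, eval_sub, eval_X, eval_C, mul_assoc]

end PartialFractions

/-! ### The rational function attached to an exponential sum -/

namespace ExtExpSum

variable (y : ExtExpSum)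

/-- The polynomial factor of the `j`-th term. -/
def coefPoly (j : Fin y.M) : ℂ[X] := ∑ m ∈ Finset.range (y.n j + 1), monomial m (y.γ j m)

theorem coeff_coefPoly (j : Fin y.M) (m : ℕ) :
    (y.coefPoly j).coeff m = if m ≤ y.n j then y.γ j m else 0 := by
  simp [coefPoly, coeff_monomial]

theorem natDegree_coefPoly (j : Fin y.M) : (y.coefPoly j).natDegree = y.n j := by
  refine le_antisymm (natDegree_le_iff_coeff_eq_zero.mpr fun m hm => ?_)
    (le_natDegree_of_ne_zero ?_)
  · rw [coeff_coefPoly, if_neg (by omega)]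
  · rw [coeff_coefPoly, if_pos le_rfl]
    exact y.leading_ne_zero j

theorem coefPoly_ne_zero (j : Fin y.M) : y.coefPoly j ≠ 0 := fun h => by
  have := y.coeff_coefPoly j (y.n j)
  rw [h, if_pos le_rfl] at this
  exact y.leading_ne_zero j this.symm

theorem toFun_eq (t : ℝ) : y.toFun t =
    ∑ j, (y.coefPoly j).eval (t : ℂ) * Complex.exp (2 * Real.pi * y.lam j * t) := by
  simp [toFun, coefPoly, eval_finsetSum]

theorem fourierCoef_eq_sum (P : ℝ) (k : ℤ) :
    y.fourierCoef P k = ∑ j, expPolyCoef P (y.coefPoly j) (y.lam j) k := by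
  simp only [fourierCoef, expPolyCoef, toFun_eq, Finset.sum_mul]
  rw [intervalIntegral.integral_finsetSum, Finset.mul_sum]
  intro j _
  have := (y.coefPoly j).continuous
  exact Continuous.intervalIntegrable (by fun_prop) _ _

/-- The pole of the `j`-th term of the rational function given by the Fourier coefficients. -/
def pole (P : ℝ) (j : Fin y.M) : ℂ := -Complex.I * y.lam j * P

theorem pole_injective {P : ℝ} (hP : P ≠ 0) : Function.Injective (y.pole P) := by
  intro i j h
  have hP' : (P : ℂ) ≠ 0 := by exact_mod_cast hP
  have h1 := mul_right_cancel₀ hP' h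
  exact y.lam_injective (mul_left_cancel₀ (neg_ne_zero.mpr Complex.I_ne_zero) h1)

theorem numPeriodic_le_order (P : ℝ) : y.numPeriodic P ≤ y.order := by
  classical
  unfold numPeriodic order
  refine (Finset.card_le_univ _).trans ?_
  rw [Finset.sum_add_distrib]
  simp

theorem exists_periodicFinset {P : ℝ} (hP : P ≠ 0) :
    ∃ T : Finset ℤ, (T : Set ℤ) = y.periodicSet P ∧ T.card = y.numPeriodic P := by
  classical
  have hf : (y.periodicSet P).Finite := by
    refine Set.Finite.subset ((Set.finite_range (y.pole P)).preimage
      (f := fun k : ℤ => (k : ℂ)) (Int.cast_injective.injOn)) ?_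
    rintro k ⟨j, hj⟩
    exact ⟨j, hj⟩
  refine ⟨hf.toFinset, hf.coe_toFinset, ?_⟩
  unfold numPeriodic
  rw [← Finset.card_image_of_injective hf.toFinset (Int.cast_injective (α := ℂ)),
    ← Finset.card_image_of_injective (Finset.univ.filter fun j => y.IsPeriodicTerm P j)
      (y.pole_injective hP)]
  congr 1
  ext z
  simp only [Finset.mem_image, Set.Finite.mem_toFinset, Finset.mem_filter, Finset.mem_univ,
    true_and]
  constructor
  · rintro ⟨k, ⟨j, hj⟩, rfl⟩
    exact ⟨j, ⟨k, hj⟩, hj⟩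
  · rintro ⟨j, ⟨k, hk⟩, rfl⟩
    exact ⟨k, ⟨j, hk⟩, hk.symm⟩

/-- The Fourier coefficients are the values of a proper rational function `p / q` of degree `N - M₂`
in lowest terms, at all integers except those in `Σ`. -/
theorem exists_rational_fourierCoef {P : ℝ} (hP : P ≠ 0) :
    ∃ p q : ℂ[X], q.Monic ∧ q.natDegree = y.order - y.numPeriodic P ∧
      p.degree < ((y.order - y.numPeriodic P : ℕ) : WithBot ℕ) ∧ IsCoprime p q ∧
      (∀ k : ℤ, k ∉ y.periodicSet P →
        q.eval (k : ℂ) ≠ 0 ∧ p.eval (k : ℂ) = y.fourierCoef P k * q.eval (k : ℂ)) ∧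
      ∀ k : ℤ, k ∈ y.periodicSet P → p.eval (k : ℂ) ≠ y.fourierCoef P k * q.eval (k : ℂ) := by
  classical
  set e : Fin y.M → ℕ := fun j => if y.IsPeriodicTerm P j then y.n j else y.n j + 1 with he
  have hsum : ∑ j, e j = y.order - y.numPeriodic P := by
    have : ∑ j, e j + y.numPeriodic P = y.order := by
      rw [numPeriodic, Finset.card_filter, ← Finset.sum_add_distrib, order]
      refine Finset.sum_congr rfl fun j _ => ?_
      simp only [he]
      split_ifs <;> omega
    omega
  have hterm : ∀ j, ∃ u : ℂ[X], u.degree < e j ∧ (e j ≠ 0 → u.eval (y.pole P j) ≠ 0) ∧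
      ∀ k : ℤ, (k : ℂ) ≠ y.pole P j →
        expPolyCoef P (y.coefPoly j) (y.lam j) k * ((k : ℂ) - y.pole P j) ^ e j
          = u.eval (k : ℂ) := by
    intro j
    refine exists_expPolyCoef_mul_pow P hP _ (y.coefPoly_ne_zero j) _ _ ?_ ?_
    · intro h
      rw [natDegree_coefPoly]
      exact if_pos h
    · intro h
      rw [natDegree_coefPoly]
      exact if_neg h
  choose u hu1 hu2 hu3 using hterm
  have ha := y.pole_injective hP
  refine ⟨fracNum (y.pole P) e u, fracDen (y.pole P) e, fracDen_monic _ _, ?_, ?_,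
    isCoprime_fracNum_fracDen ha hu2, ?_, ?_⟩
  · rw [natDegree_fracDen, hsum]
  · rw [← hsum]
    exact degree_fracNum_lt hu1
  · intro k hk
    have hk' : ∀ j, (k : ℂ) ≠ y.pole P j := fun j h => hk ⟨j, h.symm⟩
    refine ⟨eval_fracDen_ne_zero fun j _ => hk' j, ?_⟩
    rw [fourierCoef_eq_sum, sum_mul_eval_fracDen _ fun j => hu3 j k (hk' j)]
  · rintro k ⟨i, hi⟩ heq
    have hi' : (k : ℂ) = y.pole P i := hi.symm
    -- If `e i = 0`, then `q(k) ≠ 0` and `p(k) / q(k)` misses exactly the nonzero contribution of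
    -- the `i`-th term to `c_k`. Otherwise `q(k) = 0` while `p(k) ≠ 0`.
    by_cases h0 : e i = 0
    · have hden : (fracDen (y.pole P) e).eval (k : ℂ) ≠ 0 := by
        refine eval_fracDen_ne_zero fun j hj h => hj ?_
        rw [← ha (hi'.symm.trans h), h0]
      have hui : u i = 0 := by
        have := hu1 i
        rw [h0] at this
        simpa using this
      -- The fraction of the `i`-th term is zero because `deg (u i) < 0`, so its value is replaced
      -- by `0`.
      rw [fourierCoef_eq_sum, ← sum_mul_eval_fracDen
        (Function.update (fun j => expPolyCoef P (y.coefPoly j) (y.lam j) k) i 0)] at heq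
      · have := mul_right_cancel₀ hden heq
        rw [Finset.sum_update_of_mem (Finset.mem_univ i), zero_add,
          ← Finset.add_sum_erase Finset.univ _ (Finset.mem_univ i), Finset.sdiff_singleton_eq_erase,
          right_eq_add] at this
        refine expPolyCoef_ne_zero P hP _ (y.coefPoly_ne_zero i) ?_ _ k hi this
        rw [natDegree_coefPoly]
        simp only [he] at h0
        rwa [if_pos ⟨k, hi⟩] at h0
      · intro j
        rcases eq_or_ne j i with rfl | hj
        · simp [hui]
        · rw [Function.update_of_ne hj]
          exact hu3 j k fun h => hj (ha (h.symm.trans hi'))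
    · rw [hi', eval_fracDen_of_pole h0, mul_zero] at heq
      exact eval_fracNum_of_pole ha h0 (hu2 i h0) heq

end ExtExpSum

/-! ## Barycentric forms and the modified AAA algorithm -/

section Barycentric

variable {ι : Type*} [DecidableEq ι] (x : ι → ℂ) (S : Finset ι) (c : ↥S → ℂ)

/-- The polynomial `(∑ k, c k / (X - x k)) * ∏ l, (X - x l)`. -/
def baryPoly : ℂ[X] := ∑ k : ↥S, C (c k) * ∏ l ∈ S.erase k, (X - C (x l))

theorem monic_prod_erase (k : ι) : (∏ l ∈ S.erase k, (X - C (x l))).Monic :=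
  monic_prod_of_monic _ _ fun l _ => monic_X_sub_C (x l)

theorem natDegree_prod_erase (k : ↥S) :
    (∏ l ∈ S.erase k, (X - C (x l))).natDegree = S.card - 1 := by
  rw [natDegree_prod_of_monic _ _ fun l _ => monic_X_sub_C (x l)]
  simp [Finset.card_erase_of_mem k.2]

theorem natDegree_baryPoly_le : (baryPoly x S c).natDegree ≤ S.card - 1 := by
  refine natDegree_sum_le_of_forall_le _ _ fun k _ => ?_
  exact (natDegree_C_mul_le _ _).trans (natDegree_prod_erase x S k).le

theorem coeff_baryPoly : (baryPoly x S c).coeff (S.card - 1) = ∑ k, c k := by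
  rw [baryPoly, finsetSum_coeff]
  refine Finset.sum_congr rfl fun k _ => ?_
  rw [coeff_C_mul, ← natDegree_prod_erase x S k, (monic_prod_erase x S k).coeff_natDegree, mul_one]

theorem eval_baryPoly_node (k : ↥S) :
    (baryPoly x S c).eval (x k) = c k * ∏ l ∈ S.erase k, (x k - x l) := by
  rw [baryPoly, eval_finsetSum, Finset.sum_eq_single k]
  · simp [eval_prod]
  · intro j _ hj
    rw [eval_mul, eval_prod, Finset.prod_eq_zero (i := (k : ι)), mul_zero]
    · exact Finset.mem_erase.mpr ⟨fun h => hj (Subtype.ext h.symm), k.2⟩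
    · simp
  · simp

theorem eval_baryPoly {z : ℂ} (hz : ∀ l ∈ S, z ≠ x l) :
    (baryPoly x S c).eval z = (∑ k : ↥S, c k / (z - x k)) * ∏ l ∈ S, (z - x l) := by
  rw [baryPoly, eval_finsetSum, Finset.sum_mul]
  refine Finset.sum_congr rfl fun k _ => ?_
  rw [← Finset.mul_prod_erase S _ k.2]
  have := sub_ne_zero.mpr (hz k k.2)
  simp only [eval_mul, eval_C, eval_prod, eval_sub, eval_X]
  field_simp

theorem sum_C_div_X_sub_C : (∑ k : ↥S, RatFunc.C (c k) / (RatFunc.X - RatFunc.C (x k))) =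
    algebraMap ℂ[X] (RatFunc ℂ) (baryPoly x S c) /
      algebraMap ℂ[X] (RatFunc ℂ) (∏ l ∈ S, (X - C (x l))) := by
  rw [baryPoly, map_sum, Finset.sum_div]
  refine Finset.sum_congr rfl fun k _ => ?_
  rw [← Finset.mul_prod_erase S _ k.2, map_mul, map_mul, mul_div_mul_right, map_sub,
    RatFunc.algebraMap_C, RatFunc.algebraMap_X, RatFunc.algebraMap_C]
  exact RatFunc.algebraMap_ne_zero (monic_prod_erase x S k).ne_zero

variable {x} {S} {c}

theorem prod_erase_sub_ne_zero (hx : Function.Injective x) (k : ι) :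
    ∏ l ∈ S.erase k, (x k - x l) ≠ 0 :=
  Finset.prod_ne_zero_iff.mpr fun _ hl =>
    sub_ne_zero.mpr fun h => (Finset.mem_erase.mp hl).1 (hx h).symm

theorem eq_zero_of_baryPoly_eq_zero (hx : Function.Injective x) (h : baryPoly x S c = 0) :
    c = 0 := by
  funext k
  have := eval_baryPoly_node x S c k
  rw [h, eval_zero] at this
  exact (mul_eq_zero.mp this.symm).resolve_right (prod_erase_sub_ne_zero hx _)

/-- Lagrange interpolation: both polynomials have degree below `|S|` and agree at the nodes. -/
theorem eq_baryPoly (hx : Function.Injective x) {p : ℂ[X]} (hp : p.natDegree < S.card)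
    (h : ∀ k : ↥S, p.eval (x k) = c k * ∏ l ∈ S.erase k, (x k - x l)) : p = baryPoly x S c := by
  refine sub_eq_zero.mp (eq_zero_of_natDegree_lt_card_of_eval_eq_zero' _ (S.image x) ?_ ?_)
  · intro z hz
    obtain ⟨k, hk, rfl⟩ := Finset.mem_image.mp hz
    rw [eval_sub, h ⟨k, hk⟩, eval_baryPoly_node x S c ⟨k, hk⟩, sub_self]
  · rw [Finset.card_image_of_injective _ hx]
    refine (natDegree_sub_le _ _).trans_lt (max_lt hp ?_)
    have := natDegree_baryPoly_le x S c
    omega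

end Barycentric

/-- The pair `p`, `q` solves the linearized interpolation problem `p = f q` on the given points,
and all solutions of degree at most `N = deg q` are multiples of it. -/
structure AAAInput.IsMinimalSolution {ι : Type*} (I : AAAInput ι) (N : ℕ) (p q : ℂ[X]) : Prop where
  monic : q.Monic
  natDegree_eq : q.natDegree = N
  degree_lt : p.degree < (N : WithBot ℕ)
  eval_eq : ∀ z ∈ I.Γ, p.eval (I.x z) = I.f z * q.eval (I.x z)
  exists_mul : ∀ p' q' : ℂ[X], p'.natDegree ≤ N → q'.natDegree ≤ N →
    (∀ z ∈ I.Γ, p'.eval (I.x z) = I.f z * q'.eval (I.x z)) → ∃ h, q' = q * h ∧ p' = p * h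

/-! ### Singular vectors and the kernel of the Loewner matrix -/

namespace AAAInput

open scoped ComplexOrder in
-- If all singular values were positive, expanding `w` in the basis `V` and applying `AᴴA` would
-- give `w = 0`. So some singular value is `0`, and by monotonicity the first one is.
theorem IsRightSingularSystem.mulVec_zero_eq_zero {ι m : Type*} [Fintype m] {S : Finset ι}
    {A : Matrix m ↥S ℂ} {V : OrthonormalBasis (Fin S.card) ℂ (EuclideanSpace ℂ ↥S)}
    {σ : Fin S.card → ℝ} (h : IsRightSingularSystem A V σ) {i₁ : Fin S.card} (hi : (i₁ : ℕ) = 0)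
    {w : EuclideanSpace ℂ ↥S} (hw : w ≠ 0) (hA : A *ᵥ w.ofLp = 0) : A *ᵥ (V i₁).ofLp = 0 := by
  obtain ⟨hmono, hnn, heig⟩ := h
  have h0 : ∃ i, σ i = 0 := by
    by_contra! hne
    refine hw ?_
    have hsum := V.sum_repr w
    have h1 : (Aᴴ * A) *ᵥ w.ofLp = 0 :=
      (Matrix.conjTranspose_mul_self_mulVec_eq_zero A _).mpr hA
    have h2 : ∑ i, (V.repr w i * (σ i : ℂ) ^ 2) • V i = 0 := by
      apply (WithLp.ofLp_injective 2)
      rw [← hsum] at h1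
      simp only [WithLp.ofLp_sum, WithLp.ofLp_smul, Matrix.mulVec_sum, Matrix.mulVec_smul, heig,
        smul_smul] at h1
      simpa only [WithLp.ofLp_sum, WithLp.ofLp_smul, WithLp.ofLp_zero] using h1
    have h3 := Fintype.linearIndependent_iff.mp V.orthonormal.linearIndependent _ h2
    rw [← hsum]
    refine Finset.sum_eq_zero fun i _ => ?_
    have hσ : (σ i : ℂ) ^ 2 ≠ 0 := pow_ne_zero _ (by exact_mod_cast hne i)
    rw [(mul_eq_zero.mp (h3 i)).resolve_right hσ, zero_smul]
  obtain ⟨i, hi0⟩ := h0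
  have hz : σ i₁ = 0 := le_antisymm ((hmono (by rw [Fin.le_def, hi]; omega)).trans hi0.le) (hnn _)
  rw [← Matrix.conjTranspose_mul_self_mulVec_eq_zero, heig, hz]
  simp

variable {ι : Type*} [DecidableEq ι] (I : AAAInput ι)

/-- The numerator of the barycentric form, multiplied by the node polynomial. -/
def numPoly (S : Finset ι) (w : EuclideanSpace ℂ ↥S) : ℂ[X] :=
  baryPoly I.x S fun k => w k * I.f k

/-- The denominator of the barycentric form, multiplied by the node polynomial. -/
def denPoly (S : Finset ι) (w : EuclideanSpace ℂ ↥S) : ℂ[X] :=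
  baryPoly I.x S fun k => w k

theorem loewner_mulVec (S : Finset ι) (w : EuclideanSpace ℂ ↥S) (z : ↥(I.Γ \ S)) :
    (I.loewner S *ᵥ w.ofLp) z = I.f z * I.denVal S w z - I.numVal S w z := by
  simp only [Matrix.mulVec, dotProduct, loewner, Matrix.of_apply, denVal, numVal, Finset.mul_sum,
    ← Finset.sum_sub_distrib]
  refine Finset.sum_congr rfl fun k _ => ?_
  ring

theorem ratFunc_eq (S : Finset ι) (w : EuclideanSpace ℂ ↥S) : I.ratFunc S w =
    algebraMap ℂ[X] (RatFunc ℂ) (I.numPoly S w) / algebraMap ℂ[X] (RatFunc ℂ) (I.denPoly S w) := by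
  rw [ratFunc, sum_C_div_X_sub_C, sum_C_div_X_sub_C, div_div_div_cancel_right₀]
  · rfl
  · exact RatFunc.algebraMap_ne_zero
      (monic_prod_of_monic _ _ fun l _ => monic_X_sub_C (I.x l)).ne_zero

variable {I}

/-- At the nodes the linearized equation is built into the barycentric form; at the other points it
is a row of the Loewner system times the nonzero node polynomial. -/
theorem loewner_mulVec_eq_zero_iff (hx : Function.Injective I.x) {S : Finset ι}
    (w : EuclideanSpace ℂ ↥S) : I.loewner S *ᵥ w.ofLp = 0 ↔
      ∀ z ∈ I.Γ, (I.numPoly S w).eval (I.x z) = I.f z * (I.denPoly S w).eval (I.x z) := by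
  have hmem : ∀ z ∈ S, (I.numPoly S w).eval (I.x z) = I.f z * (I.denPoly S w).eval (I.x z) := by
    intro z hz
    rw [numPoly, denPoly, eval_baryPoly_node I.x S _ ⟨z, hz⟩, eval_baryPoly_node I.x S _ ⟨z, hz⟩]
    ring
  have hnot : ∀ z ∉ S, ((I.numPoly S w).eval (I.x z) = I.f z * (I.denPoly S w).eval (I.x z) ↔
      I.f z * I.denVal S w z - I.numVal S w z = 0) := by
    intro z hz
    have hne : ∀ l ∈ S, I.x z ≠ I.x l := fun l hl h => hz (hx h ▸ hl)
    have hprod : ∏ l ∈ S, (I.x z - I.x l) ≠ 0 :=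
      Finset.prod_ne_zero_iff.mpr fun l hl => sub_ne_zero.mpr (hne l hl)
    rw [numPoly, denPoly, eval_baryPoly _ _ _ hne, eval_baryPoly _ _ _ hne, ← mul_assoc,
      mul_left_inj' hprod, sub_eq_zero, eq_comm]
    rfl
  constructor
  · intro h z hz
    by_cases hzS : z ∈ S
    · exact hmem z hzS
    · have := congrFun h ⟨z, Finset.mem_sdiff.mpr ⟨hz, hzS⟩⟩
      rw [loewner_mulVec] at this
      exact (hnot z hzS).mpr this
  · intro h
    funext z
    have hz := Finset.mem_sdiff.mp z.2
    rw [loewner_mulVec]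
    exact (hnot z hz.2).mp (h z hz.1)

/-- The denominator has degree at most `|S| - 1 < N` but must be a multiple of `q`, so it vanishes,
and its node values determine the weights. -/
theorem eq_zero_of_loewner_mulVec_eq_zero (hx : Function.Injective I.x) {N : ℕ} {p q : ℂ[X]}
    (hm : I.IsMinimalSolution N p q) {S : Finset ι} (hS : S.card ≤ N) {w : EuclideanSpace ℂ ↥S}
    (h : I.loewner S *ᵥ w.ofLp = 0) : w = 0 := by
  -- For empty `S` the truncated `|S| - 1` is `0`, which need not be less than `N`.
  rcases S.eq_empty_or_nonempty with rfl | hne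
  · ext k
    exact absurd k.2 (Finset.notMem_empty _)
  have hpos := hne.card_pos
  have hden := natDegree_baryPoly_le I.x S fun k => w k
  obtain ⟨u, hu, -⟩ := hm.exists_mul (I.numPoly S w) (I.denPoly S w)
    ((natDegree_baryPoly_le _ _ _).trans (by omega)) (hden.trans (by omega))
    ((loewner_mulVec_eq_zero_iff hx w).mp h)
  have hzero : I.denPoly S w = 0 := by
    by_contra hd
    have hu0 : u ≠ 0 := fun h0 => hd (by rw [hu, h0, mul_zero])
    have : (I.denPoly S w).natDegree = N + u.natDegree := by
      rw [hu, natDegree_mul hm.monic.ne_zero hu0, hm.natDegree_eq]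
    have h1 : (I.denPoly S w).natDegree ≤ S.card - 1 := hden
    omega
  ext k
  exact congrFun (eq_zero_of_baryPoly_eq_zero hx hzero) k

theorem exists_loewner_mulVec_eq_zero (hx : Function.Injective I.x) {N : ℕ} {p q : ℂ[X]}
    (hm : I.IsMinimalSolution N p q) {S : Finset ι} (hSΓ : S ⊆ I.Γ) (hS : S.card = N + 1) :
    ∃ w : EuclideanSpace ℂ ↥S, w ≠ 0 ∧ I.loewner S *ᵥ w.ofLp = 0 := by
  -- The weights that write `q` in barycentric form on `N + 1` nodes; the interpolation conditions
  -- then produce `p` as numerator.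
  set w : EuclideanSpace ℂ ↥S := WithLp.toLp 2 fun k =>
    q.eval (I.x k) / ∏ l ∈ S.erase k, (I.x k - I.x l) with hw
  have hwk : ∀ k : ↥S, q.eval (I.x k) = w k * ∏ l ∈ S.erase k, (I.x k - I.x l) := fun k => by
    rw [hw]
    exact (div_mul_cancel₀ _ (prod_erase_sub_ne_zero hx _)).symm
  have hq : q = I.denPoly S w := eq_baryPoly hx (by rw [hm.natDegree_eq]; omega) hwk
  have hp : p = I.numPoly S w := by
    refine eq_baryPoly hx ?_ fun k => ?_
    · rw [hS, Nat.lt_succ_iff]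
      exact natDegree_le_of_degree_le hm.degree_lt.le
    · rw [hm.eval_eq k (hSΓ k.2), hwk]
      ring
  refine ⟨w, fun h0 => hm.monic.ne_zero ?_, ?_⟩
  · rw [hq, h0]
    simp [denPoly, baryPoly]
  · rw [loewner_mulVec_eq_zero_iff hx, ← hq, ← hp]
    exact hm.eval_eq

theorem exists_C_mul_of_loewner_mulVec_eq_zero (hx : Function.Injective I.x) {N : ℕ} {p q : ℂ[X]}
    (hm : I.IsMinimalSolution N p q) {S : Finset ι} (hS : S.card = N + 1)
    {w : EuclideanSpace ℂ ↥S} (h : I.loewner S *ᵥ w.ofLp = 0) :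
    ∃ c : ℂ, I.denPoly S w = q * C c ∧ I.numPoly S w = p * C c := by
  have hden := natDegree_baryPoly_le I.x S fun k => w k
  obtain ⟨u, hu, hu'⟩ := hm.exists_mul (I.numPoly S w) (I.denPoly S w)
    ((natDegree_baryPoly_le _ _ _).trans (by omega)) (hden.trans (by omega))
    ((loewner_mulVec_eq_zero_iff hx w).mp h)
  rcases eq_or_ne u 0 with rfl | hu0
  · exact ⟨0, by simpa using hu, by simpa using hu'⟩
  have h1 : (I.denPoly S w).natDegree = N + u.natDegree := by
    rw [hu, natDegree_mul hm.monic.ne_zero hu0, hm.natDegree_eq]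
  have h2 : (I.denPoly S w).natDegree ≤ S.card - 1 := hden
  have h3 := eq_C_of_natDegree_eq_zero (p := u) (by omega)
  exact ⟨u.coeff 0, by rw [← h3, hu], by rw [← h3, hu']⟩

/-- The sum is the coefficient of `X ^ N` in a scalar multiple of `p`, and `deg p < N`. -/
theorem dotData_eq_zero (hx : Function.Injective I.x) {N : ℕ} {p q : ℂ[X]}
    (hm : I.IsMinimalSolution N p q) {S : Finset ι} (hS : S.card = N + 1)
    {w : EuclideanSpace ℂ ↥S} (h : I.loewner S *ᵥ w.ofLp = 0) : I.dotData S w = 0 := by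
  obtain ⟨c, -, hc⟩ := exists_C_mul_of_loewner_mulVec_eq_zero hx hm hS h
  have h1 := coeff_baryPoly I.x S fun k => w k * I.f k
  rw [show baryPoly I.x S (fun k => w k * I.f k) = p * C c from hc, hS, coeff_mul_C,
    coeff_eq_zero_of_degree_lt (by simpa using hm.degree_lt), zero_mul] at h1
  exact h1.symm

open scoped ComplexOrder in
theorem exists_isRightSingularSystem {m : Type*} [Fintype m] {S : Finset ι} (A : Matrix m ↥S ℂ) :
    ∃ V σ, IsRightSingularSystem A V σ := by
  have hT := Matrix.isSymmetric_toEuclideanLin_iff.mpr (Matrix.isHermitian_conjTranspose_mul_self A)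
  have hn : Module.finrank ℂ (EuclideanSpace ℂ ↥S) = S.card := by simp
  have heig : ∀ i, (Aᴴ * A) *ᵥ (hT.eigenvectorBasis hn i).ofLp
      = (hT.eigenvalues hn i : ℂ) • (hT.eigenvectorBasis hn i).ofLp := fun i =>
    congrArg WithLp.ofLp (hT.apply_eigenvectorBasis hn i)
  have hpos : ∀ i, 0 ≤ hT.eigenvalues hn i := by
    intro i
    have h2 := (Matrix.posSemidef_conjTranspose_mul_self A).re_dotProduct_nonneg
      (hT.eigenvectorBasis hn i).ofLp
    rw [heig, dotProduct_smul, dotProduct_comm, ← EuclideanSpace.inner_eq_star_dotProduct,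
      inner_self_eq_norm_sq_to_K, (hT.eigenvectorBasis hn).norm_eq_one] at h2
    simpa using h2
  -- The eigenvalues come in decreasing order, hence the reversal.
  refine ⟨(hT.eigenvectorBasis hn).reindex Fin.revPerm,
    fun i => Real.sqrt (hT.eigenvalues hn (Fin.rev i)), ?_, fun i => Real.sqrt_nonneg _, ?_⟩
  · intro i j hij
    exact Real.sqrt_le_sqrt (hT.eigenvalues_antitone hn (Fin.rev_le_rev.mpr hij))
  · intro i
    rw [← Complex.ofReal_pow, Real.sq_sqrt (hpos _), OrthonormalBasis.reindex_apply]
    exact heig (Fin.rev i)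

theorem exists_isWeight {S : Finset ι} (hS : 2 ≤ S.card) : ∃ w, I.IsWeight S w := by
  classical
  obtain ⟨V, σ, h⟩ := exists_isRightSingularSystem (I.loewner S)
  let w₀ : EuclideanSpace ℂ ↥S := I.dotData S (V ⟨1, by omega⟩) • V ⟨0, by omega⟩
    - I.dotData S (V ⟨0, by omega⟩) • V ⟨1, by omega⟩
  exact ⟨if w₀ = 0 then V ⟨0, by omega⟩ else ((‖w₀‖⁻¹ : ℝ) : ℂ) • w₀, V, σ, _, _, h, rfl, rfl, w₀,
    rfl, fun h0 => if_neg h0, fun h0 => if_pos h0⟩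

theorem IsWeight.norm_eq_one {S : Finset ι} {w : EuclideanSpace ℂ ↥S} (h : I.IsWeight S w) :
    ‖w‖ = 1 := by
  obtain ⟨V, σ, i₁, i₂, -, -, -, w₀, -, h1, h2⟩ := h
  by_cases h0 : w₀ = 0
  · rw [h2 h0, V.norm_eq_one]
  · rw [h1 h0, norm_smul]
    simp [h0]

/-- Since `v₁` lies in the kernel, `v₁ᵀ f_S = 0`. The combination is therefore a multiple of `v₁`
alone, whatever `v₂` is. -/
theorem IsWeight.loewner_mulVec_eq_zero (hx : Function.Injective I.x) {N : ℕ} {p q : ℂ[X]}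
    (hm : I.IsMinimalSolution N p q) {S : Finset ι} (hSΓ : S ⊆ I.Γ) (hS : S.card = N + 1)
    {w : EuclideanSpace ℂ ↥S} (h : I.IsWeight S w) : I.loewner S *ᵥ w.ofLp = 0 := by
  obtain ⟨V, σ, i₁, i₂, hV, hi₁, -, w₀, hw₀, h1, h2⟩ := h
  obtain ⟨w', hw', hAw'⟩ := exists_loewner_mulVec_eq_zero hx hm hSΓ hS
  have hA := hV.mulVec_zero_eq_zero hi₁ hw' hAw'
  rw [dotData_eq_zero hx hm hS hA, zero_smul, sub_zero] at hw₀
  by_cases h0 : w₀ = 0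
  · rw [h2 h0, hA]
  · rw [h1 h0, hw₀, WithLp.ofLp_smul, WithLp.ofLp_smul, Matrix.mulVec_smul, Matrix.mulVec_smul, hA,
      smul_zero, smul_zero]

/-! ### The stopping test and the choice of the tolerance -/

theorem stops_of_loewner_mulVec_eq_zero (htol : 0 < I.tol) {S : Finset ι}
    {w : EuclideanSpace ℂ ↥S} (h : I.loewner S *ᵥ w.ofLp = 0) : I.Stops S w := by
  intro z hz
  have h1 := congrFun h ⟨z, hz⟩
  rw [loewner_mulVec, Pi.zero_apply, sub_eq_zero] at h1
  have h2 : 0 < ENNReal.ofReal I.tol := ENNReal.ofReal_pos.mpr htol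
  unfold error
  split_ifs with hd hn
  · rw [← h1, mul_div_cancel_right₀ _ hd, sub_self, norm_zero, ENNReal.ofReal_zero]
    exact h2
  · exact h2
  · rw [not_not] at hd
    rw [hd, mul_zero] at h1
    exact absurd h1.symm hn

/-- Clearing the denominator gives a bound that also holds trivially where `p(z) = q(z) = 0`. -/
theorem Stops.norm_loewner_mulVec_le (htol : 0 < I.tol) {S : Finset ι} {w : EuclideanSpace ℂ ↥S}
    (h : I.Stops S w) (z : ↥(I.Γ \ S)) :
    ‖(I.loewner S *ᵥ w.ofLp) z‖ ≤ I.tol * ‖I.denVal S w z‖ := by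
  have h1 := h z z.2
  rw [loewner_mulVec]
  unfold error at h1
  split_ifs at h1 with hd hn
  · have h2 := ((ENNReal.ofReal_lt_ofReal_iff htol).mp h1).le
    calc ‖I.f z * I.denVal S w z - I.numVal S w z‖
        = ‖I.numVal S w z / I.denVal S w z - I.f z‖ * ‖I.denVal S w z‖ := by
          rw [← norm_mul, sub_mul, div_mul_cancel₀ _ hd, norm_sub_rev]
      _ ≤ _ := by gcongr
  · rw [not_not] at hd
    simp [hd, hn]
  · exact absurd h1 (by simp)

/-- The values of the denominator at the points that are not interpolated. -/
def denValLin (S : Finset ι) : EuclideanSpace ℂ ↥S →ₗ[ℂ] ↥(I.Γ \ S) → ℂ :=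
  Matrix.toLin' (Matrix.of fun (z : ↥(I.Γ \ S)) (k : ↥S) => (I.x z - I.x k)⁻¹) ∘ₗ
    (WithLp.linearEquiv 2 ℂ (↥S → ℂ)).toLinearMap

theorem denValLin_apply (S : Finset ι) (w : EuclideanSpace ℂ ↥S) (z : ↥(I.Γ \ S)) :
    I.denValLin S w z = I.denVal S w z := by
  simp [denValLin, denVal, Matrix.mulVec, dotProduct, div_eq_mul_inv, mul_comm]

/-- If the Loewner matrix has trivial kernel, the linearized residual is not small relative to the
denominator. -/
theorem exists_pos_mul_denVal_lt {S : Finset ι}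
    (hker : ∀ w : EuclideanSpace ℂ ↥S, I.loewner S *ᵥ w.ofLp = 0 → w = 0) :
    ∃ ε > 0, ∀ w : EuclideanSpace ℂ ↥S, w ≠ 0 →
      ∃ z : ↥(I.Γ \ S), ε * ‖I.denVal S w z‖ < ‖(I.loewner S *ᵥ w.ofLp) z‖ := by
  let A : EuclideanSpace ℂ ↥S →ₗ[ℂ] ↥(I.Γ \ S) → ℂ :=
    Matrix.toLin' (I.loewner S) ∘ₗ (WithLp.linearEquiv 2 ℂ (↥S → ℂ)).toLinearMap
  have hA : ∀ w, A w = I.loewner S *ᵥ w.ofLp := fun w => rfl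
  obtain ⟨K, hK, hAK⟩ := A.exists_antilipschitzWith (LinearMap.ker_eq_bot'.mpr hker)
  set B := LinearMap.toContinuousLinearMap (I.denValLin S) with hB
  have hKB : 0 ≤ (K : ℝ) * ‖B‖ := by positivity
  -- With this `ε`, the opposite inequalities would give `‖A w‖ ≤ ε K ‖B‖ ‖A w‖` with `ε K ‖B‖ < 1`,
  -- hence `A w = 0`. The summand `1` covers `K ‖B‖ = 0`.
  refine ⟨(K * ‖B‖ + 1)⁻¹, by positivity, fun w hw => ?_⟩
  by_contra! hle
  have hw1 : ‖w‖ ≤ K * ‖A w‖ := by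
    simpa using hAK.le_mul_dist w 0
  have h1 : ‖A w‖ ≤ (K * ‖B‖ + 1)⁻¹ * (‖B‖ * ‖w‖) := by
    refine (pi_norm_le_iff_of_nonneg (by positivity)).mpr fun z => ?_
    refine (hle z).trans ?_
    gcongr
    rw [← denValLin_apply]
    exact (norm_le_pi_norm (B w) z).trans (B.le_opNorm w)
  have h2 : (K * ‖B‖ + 1) * ‖A w‖ ≤ K * ‖B‖ * ‖A w‖ := by
    calc (K * ‖B‖ + 1) * ‖A w‖ ≤ ‖B‖ * ‖w‖ := by
          rwa [inv_mul_eq_div, le_div_iff₀' (by positivity)] at h1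
      _ ≤ ‖B‖ * (K * ‖A w‖) := by gcongr
      _ = _ := by ring
  have h3 : ‖A w‖ ≤ 0 := by linarith
  exact hw (hker w (norm_le_zero_iff.mp h3))

/-- The residual bound depends only on `S`, so its minimum over the finitely many subsets of `Γ`
serves all runs. -/
theorem exists_pos_not_stops (hx : Function.Injective I.x) {N : ℕ} {p q : ℂ[X]}
    (hm : I.IsMinimalSolution N p q) :
    ∃ tol₀ > 0, ∀ tol, 0 < tol → tol ≤ tol₀ → ∀ (jmax : ℕ), ∀ S ⊆ I.Γ, S.card ≤ N →
      ∀ w : EuclideanSpace ℂ ↥S, w ≠ 0 → ¬ (AAAInput.mk I.x I.f I.Γ tol jmax).Stops S w := by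
  have h1 : ∀ S : Finset ι, ∃ ε > 0, S.card ≤ N → ∀ w : EuclideanSpace ℂ ↥S, w ≠ 0 →
      ∃ z : ↥(I.Γ \ S), ε * ‖I.denVal S w z‖ < ‖(I.loewner S *ᵥ w.ofLp) z‖ := by
    intro S
    by_cases hS : S.card ≤ N
    · obtain ⟨ε, hε, h⟩ := exists_pos_mul_denVal_lt (I := I) (S := S) fun w hw =>
        eq_zero_of_loewner_mulVec_eq_zero hx hm hS hw
      exact ⟨ε, hε, fun _ => h⟩
    · exact ⟨1, one_pos, fun h => absurd h hS⟩
  choose ε hε h using h1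
  have hne : I.Γ.powerset.Nonempty := Finset.powerset_nonempty _
  refine ⟨I.Γ.powerset.inf' hne ε, (Finset.lt_inf'_iff hne).mpr fun S _ => hε S, ?_⟩
  intro tol htol hle jmax S hS hcard w hw hstops
  obtain ⟨z, hz⟩ := h S hcard w hw
  have h2 : ‖(I.loewner S *ᵥ w.ofLp) z‖ ≤ tol * ‖I.denVal S w z‖ :=
    hstops.norm_loewner_mulVec_le (I := AAAInput.mk I.x I.f I.Γ tol jmax) htol z
  have h3 : tol ≤ ε S := hle.trans (Finset.inf'_le _ (Finset.mem_powerset.mpr hS))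
  have h4 := mul_le_mul_of_nonneg_right h3 (norm_nonneg (I.denVal S w z))
  linarith

theorem exists_reaches_one (hΓ : 2 ≤ I.Γ.card) (hj : 1 ≤ I.jmax) : ∃ S w, I.Reaches 1 S w := by
  obtain ⟨z₁, h₁, hmax₁⟩ := I.Γ.exists_max_image (fun z => ‖I.f z‖) (Finset.card_pos.mp (by omega))
  obtain ⟨z₂, h₂, hmax₂⟩ := (I.Γ.erase z₁).exists_max_image (fun z => ‖I.f z‖)
    (Finset.card_pos.mp (by rw [Finset.card_erase_of_mem h₁]; omega))
  have hne : z₁ ≠ z₂ := (Finset.ne_of_mem_erase h₂).symm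
  obtain ⟨w, hw⟩ := exists_isWeight (I := I) (S := {z₁, z₂}) (Finset.card_pair hne).ge
  refine ⟨_, w, .start z₁ z₂ w hj h₁ (Finset.mem_of_mem_erase h₂) hne (fun z hz => ?_) hw⟩
  obtain ⟨hz, hz'⟩ := Finset.mem_sdiff.mp hz
  simp only [Finset.mem_insert, Finset.mem_singleton, not_or] at hz'
  exact ⟨hmax₁ z hz, hmax₂ z (Finset.mem_erase.mpr ⟨hz'.1, hz⟩)⟩

/-! ### Runs of the algorithm -/

section Run

variable {N : ℕ} {p q : ℂ[X]}

/-- In step `N` there are `N + 1` nodes, the weight lies in the kernel and the test succeeds, so no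
further step occurs. -/
theorem Reaches.support (hx : Function.Injective I.x) (hm : I.IsMinimalSolution N p q)
    (hN : 1 ≤ N) (htol : 0 < I.tol) {j : ℕ} {S : Finset ι} {w : EuclideanSpace ℂ ↥S}
    (h : I.Reaches j S w) : S ⊆ I.Γ ∧ S.card = j + 1 ∧ j ≤ N ∧ I.IsWeight S w := by
  induction h with
  | start z₁ z₂ w hjmax h₁ h₂ hne hmax hw =>
    exact ⟨Finset.insert_subset h₁ (Finset.singleton_subset_iff.mpr h₂), Finset.card_pair hne, hN,
      hw⟩
  | next j S w z w' h hfail hjmax hz hmax hw ih =>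
    obtain ⟨hS, hcard, hj, hweight⟩ := ih
    obtain ⟨hzΓ, hzS⟩ := Finset.mem_sdiff.mp hz
    refine ⟨Finset.insert_subset hzΓ hS, by rw [Finset.card_insert_of_notMem hzS, hcard], ?_, hw⟩
    refine Nat.lt_of_le_of_ne hj fun hjN => hfail ?_
    subst hjN
    exact stops_of_loewner_mulVec_eq_zero htol (hweight.loewner_mulVec_eq_zero hx hm hS hcard)

theorem Reaches.canContinue (hx : Function.Injective I.x) (hm : I.IsMinimalSolution N p q)
    (hN : 1 ≤ N) (htol : 0 < I.tol) (hjmax : N + 1 ≤ I.jmax) (hΓ : N + 1 < I.Γ.card) {j : ℕ}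
    {S : Finset ι} {w : EuclideanSpace ℂ ↥S} (h : I.Reaches j S w) (hfail : ¬ I.Stops S w) :
    I.CanContinue j S w := by
  obtain ⟨hS, hcard, hj, -⟩ := h.support hx hm hN htol
  have hne : (I.Γ \ S).Nonempty := by
    rw [← Finset.card_pos, Finset.card_sdiff_of_subset hS]
    omega
  obtain ⟨z, hz, hmax⟩ := (I.Γ \ S).exists_max_image (I.error S w) hne
  refine ⟨hfail, by omega, z, hz, hmax, exists_isWeight ?_⟩
  rw [Finset.card_insert_of_notMem (Finset.mem_sdiff.mp hz).2]
  omega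

/-- Stopping is possible only with `N + 1` nodes. Numerator and denominator are then `p` and `q`
times the same constant, nonzero because the weight has norm `1`. -/
theorem Reaches.ratFunc_eq (hx : Function.Injective I.x) (hm : I.IsMinimalSolution N p q)
    (hN : 1 ≤ N) (htol : 0 < I.tol)
    (hns : ∀ S ⊆ I.Γ, S.card ≤ N → ∀ w : EuclideanSpace ℂ ↥S, w ≠ 0 → ¬ I.Stops S w) {j : ℕ}
    {S : Finset ι} {w : EuclideanSpace ℂ ↥S} (h : I.Reaches j S w) (hstops : I.Stops S w) :
    I.ratFunc S w = algebraMap ℂ[X] (RatFunc ℂ) p / algebraMap ℂ[X] (RatFunc ℂ) q := by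
  obtain ⟨hS, hcard, hj, hw⟩ := h.support hx hm hN htol
  have hw0 : w ≠ 0 := fun h0 => by
    have := hw.norm_eq_one
    rw [h0, norm_zero] at this
    exact zero_ne_one this
  have hcard' : S.card = N + 1 := by
    by_contra hne
    exact hns S hS (by omega) w hw0 hstops
  obtain ⟨c, hq, hp⟩ := exists_C_mul_of_loewner_mulVec_eq_zero hx hm hcard'
    (hw.loewner_mulVec_eq_zero hx hm hS hcard')
  have hc : c ≠ 0 := by
    rintro rfl
    rw [C_0, mul_zero] at hq
    refine hw0 ?_
    ext k
    exact congrFun (eq_zero_of_baryPoly_eq_zero hx hq) k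
  rw [AAAInput.ratFunc_eq, hp, hq, map_mul, map_mul, mul_div_mul_right]
  exact RatFunc.algebraMap_ne_zero (C_ne_zero.mpr hc)

end Run

end AAAInput

/-! ## Solutions of the linearized interpolation problem for Fourier coefficients -/

theorem RatFunc.num_denom_of_isCoprime {p q : ℂ[X]} (hq : q.Monic) (h : IsCoprime p q) :
    (algebraMap ℂ[X] (RatFunc ℂ) p / algebraMap ℂ[X] (RatFunc ℂ) q).num = p ∧
      (algebraMap ℂ[X] (RatFunc ℂ) p / algebraMap ℂ[X] (RatFunc ℂ) q).denom = q := by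
  have hg : gcd p q = 1 := by
    rw [← normalize_gcd, normalize_eq_one, gcd_isUnit_iff]
    exact h
  constructor
  · rw [RatFunc.num_div, hg, EuclideanDomain.div_one, hq.leadingCoeff, inv_one, C_1, one_mul,
      EuclideanDomain.div_one]
  · rw [RatFunc.denom_div _ hq.ne_zero, hg, EuclideanDomain.div_one, hq.leadingCoeff, inv_one, C_1,
      one_mul]

/-- The difference of the two products has degree at most `m + n` and vanishes at more than `m + n`
points. -/
theorem mul_eq_mul_of_eval_eq (Γ : Finset ℤ) (f : ℤ → ℂ) (p q p' q' : ℂ[X]) (m n : ℕ)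
    (hΓ : m + n < Γ.card) (hp : p.natDegree ≤ m) (hq : q.natDegree ≤ m) (hp' : p'.natDegree ≤ n)
    (hq' : q'.natDegree ≤ n) (h : ∀ k ∈ Γ, p.eval (k : ℂ) = f k * q.eval (k : ℂ))
    (h' : ∀ k ∈ Γ, p'.eval (k : ℂ) = f k * q'.eval (k : ℂ)) : p * q' = p' * q := by
  refine sub_eq_zero.mp (eq_zero_of_natDegree_lt_card_of_eval_eq_zero' _
    (Γ.image (fun k : ℤ => (k : ℂ))) ?_ ?_)
  · intro z hz
    obtain ⟨k, hk, rfl⟩ := Finset.mem_image.mp hz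
    rw [eval_sub, eval_mul, eval_mul, h k hk, h' k hk]
    ring
  · rw [Finset.card_image_of_injective _ Int.cast_injective]
    refine (natDegree_sub_le _ _).trans_lt (max_lt ?_ ?_)
    · exact natDegree_mul_le.trans_lt (by omega)
    · exact natDegree_mul_le.trans_lt (by omega)

namespace ExtExpSum

variable (y : ExtExpSum)

theorem exists_minimalSolution {P : ℝ} (hP : P ≠ 0) :
    ∃ p q s : ℂ[X], q.Monic ∧ q.natDegree = y.order - y.numPeriodic P ∧
      p.degree < ((y.order - y.numPeriodic P : ℕ) : WithBot ℕ) ∧ IsCoprime p q ∧ s.Monic ∧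
      (q * s).natDegree = y.order ∧ (p * s).degree < (y.order : WithBot ℕ) ∧
      (∀ k : ℤ, (p * s).eval (k : ℂ) = y.fourierCoef P k * (q * s).eval (k : ℂ)) ∧
      (∀ k : ℤ, k ∉ y.periodicSet P → q.eval (k : ℂ) ≠ 0 ∧ s.eval (k : ℂ) ≠ 0 ∧
        p.eval (k : ℂ) = y.fourierCoef P k * q.eval (k : ℂ)) ∧
      ∀ h : ℂ[X], (∀ k ∈ y.periodicSet P,
        (p * h).eval (k : ℂ) = y.fourierCoef P k * (q * h).eval (k : ℂ)) → s ∣ h := by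
  obtain ⟨p, q, hq, hqd, hpd, hcop, hout, hin⟩ := y.exists_rational_fourierCoef hP
  obtain ⟨T, hT, hTc⟩ := y.exists_periodicFinset hP
  have hmem : ∀ k, k ∈ T ↔ k ∈ y.periodicSet P := fun k => by rw [← hT, Finset.mem_coe]
  have hs : (∏ k ∈ T, (X - C (k : ℂ))).Monic := monic_prod_of_monic _ _ fun k _ => monic_X_sub_C _
  have hsd : (∏ k ∈ T, (X - C (k : ℂ))).natDegree = y.numPeriodic P := by
    rw [natDegree_prod_of_monic _ _ fun k _ => monic_X_sub_C _,
      Finset.sum_congr rfl fun (k : ℤ) _ => natDegree_X_sub_C (k : ℂ)]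
    simp [hTc]
  have hle := y.numPeriodic_le_order P
  have hs0 : ∀ k : ℤ, k ∈ T → (∏ k ∈ T, (X - C (k : ℂ))).eval (k : ℂ) = 0 := fun k hk => by
    rw [eval_prod, Finset.prod_eq_zero hk]
    simp
  refine ⟨p, q, _, hq, hqd, hpd, hcop, hs, ?_, ?_, fun k => ?_, fun k hk => ?_, fun h hh => ?_⟩
  · rw [hq.natDegree_mul hs, hqd, hsd]
    omega
  · rcases eq_or_ne p 0 with rfl | hp0
    · rw [zero_mul, degree_zero]
      exact WithBot.bot_lt_coe _
    · rw [degree_eq_natDegree hp0] at hpd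
      have hpd' : p.natDegree < y.order - y.numPeriodic P := by exact_mod_cast hpd
      rw [degree_mul, degree_eq_natDegree hp0, degree_eq_natDegree hs.ne_zero, hsd]
      exact_mod_cast (by omega : p.natDegree + y.numPeriodic P < y.order)
  · by_cases hk : k ∈ T
    · rw [eval_mul, eval_mul, hs0 k hk]
      ring
    · rw [eval_mul, eval_mul, (hout k (fun h => hk ((hmem k).mpr h))).2]
      ring
  · refine ⟨(hout k hk).1, ?_, (hout k hk).2⟩
    rw [eval_prod]
    refine Finset.prod_ne_zero_iff.mpr fun l hl => ?_
    rw [eval_sub, eval_X, eval_C, sub_ne_zero]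
    rintro heq
    rw [Int.cast_inj.mp heq] at hk
    exact hk ((hmem l).mp hl)
  -- If `h(k) ≠ 0` for some `k ∈ Σ`, cancelling it would yield `p(k) = c_k q(k)`, which is false on
  -- `Σ`.
  · refine Finset.prod_dvd_of_coprime ?_ fun k hk => ?_
    · exact fun k _ l _ hkl => isCoprime_X_sub_C_of_isUnit_sub
        (IsUnit.mk0 _ (sub_ne_zero.mpr (Int.cast_injective.ne hkl)))
    · rw [dvd_iff_isRoot, IsRoot.def]
      have h1 := hh k ((hmem k).mp hk)
      rw [eval_mul, eval_mul, ← mul_assoc] at h1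
      by_contra h0
      exact hin k ((hmem k).mp hk) (mul_right_cancel₀ h0 h1)

theorem isMinimalSolution {P : ℝ} {Γ : Finset ℤ} (hL : 2 * y.order < Γ.card)
    (hΓ : y.periodicSet P ⊆ ↑Γ) {p q s : ℂ[X]} (hq : q.Monic) (hcop : IsCoprime p q) (hs : s.Monic)
    (hd : (q * s).natDegree = y.order) (hpd : (p * s).degree < (y.order : WithBot ℕ))
    (hev : ∀ k : ℤ, (p * s).eval (k : ℂ) = y.fourierCoef P k * (q * s).eval (k : ℂ))
    (hdvd : ∀ h : ℂ[X], (∀ k ∈ y.periodicSet P,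
        (p * h).eval (k : ℂ) = y.fourierCoef P k * (q * h).eval (k : ℂ)) → s ∣ h)
    (tol : ℝ) (jmax : ℕ) :
    (fourierInput y P Γ tol jmax).IsMinimalSolution y.order (p * s) (q * s) where
  monic := hq.mul hs
  natDegree_eq := hd
  degree_lt := hpd
  eval_eq := fun z _ => hev z
  exists_mul := by
    intro p' q' hp' hq' h
    have hcross := mul_eq_mul_of_eval_eq Γ (y.fourierCoef P) p' q' (p * s) (q * s) y.order y.order
      (by omega) hp' hq' (natDegree_le_of_degree_le hpd.le) hd.le h fun k _ => hev k
    have hcross' : p' * q = p * q' := mul_right_cancel₀ hs.ne_zero (by linear_combination hcross)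
    obtain ⟨h₁, rfl⟩ : q ∣ q' := hcop.symm.dvd_of_dvd_mul_left (Dvd.intro_left _ hcross')
    have hp₁ : p' = p * h₁ := mul_right_cancel₀ hq.ne_zero (by linear_combination hcross')
    obtain ⟨h₂, rfl⟩ := hdvd h₁ fun k hk => by
      rw [← hp₁]
      exact h k (hΓ hk)
    exact ⟨h₂, by ring, by rw [hp₁]; ring⟩

end ExtExpSum

/-! ## Exponential sums are determined by their Fourier coefficients -/

open MeasureTheory in
/-- A continuous function on `[0, P]` is determined by its Fourier coefficients. -/
theorem eq_zero_of_fourierCoeff_eq_zero {P : ℝ} (hP : 0 < P) {f : ℝ → ℂ} (hf : Continuous f)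
    (h : ∀ k : ℤ, ∫ t in (0 : ℝ)..P, f t * Complex.exp (-2 * Real.pi * Complex.I * k * t / P) = 0) :
    ∀ t ∈ Set.Ioo 0 P, f t = 0 := by
  have : Fact (0 < P) := ⟨hP⟩
  -- The periodization may jump at the endpoint but is bounded, hence in `L²`. Completeness makes it
  -- vanish almost everywhere, and continuity of `f` gives the claim inside the interval.
  set F : AddCircle P → ℂ := AddCircle.liftIoc P 0 f with hF
  have hmeas : Measurable F :=
    (hf.measurable.comp measurable_subtype_coe).comp (AddCircle.measurableEquivIoc P 0).measurable
  obtain ⟨B, hB⟩ := (isCompact_Icc (a := (0 : ℝ)) (b := 0 + P)).exists_bound_of_continuousOn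
    hf.continuousOn
  have hbound : ∀ x, ‖F x‖ ≤ B := fun x =>
    hB _ (Set.Ioc_subset_Icc_self (AddCircle.equivIoc P 0 x).2)
  have hmem : MemLp F 2 (AddCircle.haarAddCircle (T := P)) :=
    MemLp.of_bound hmeas.aestronglyMeasurable B (Filter.Eventually.of_forall hbound)
  have hcoef : ∀ k : ℤ, fourierCoeff F k = 0 := by
    intro k
    rw [hF, fourierCoeff_liftIoc_eq, fourierCoeffOn_eq_integral]
    simp only [fourier_coe_apply, smul_eq_mul]
    simp only [zero_add, sub_zero]
    refine smul_eq_zero_of_right _ ((intervalIntegral.integral_congr fun t _ => ?_).trans (h k))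
    simp only [mul_comm (f t)]
    congr 3
    push_cast
    ring
  have hzero : hmem.toLp F = 0 := by
    apply fourierBasis.repr.injective
    ext k
    rw [fourierBasis_repr, fourierCoeff_congr_ae hmem.coeFn_toLp, hcoef, map_zero]
    rfl
  have hae : F =ᵐ[AddCircle.haarAddCircle] 0 :=
    hmem.coeFn_toLp.symm.trans (by rw [hzero]; exact Lp.coeFn_zero _ _ _)
  have hvol : F =ᵐ[volume] 0 := by
    rw [AddCircle.volume_eq_smul_haarAddCircle]
    exact Measure.ae_smul_measure hae _
  have hpre := (AddCircle.measurePreserving_mk P 0).quasiMeasurePreserving.ae_eq_comp hvol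
  have hfae : f =ᵐ[volume.restrict (Set.Ioo 0 P)] 0 := by
    refine ae_restrict_of_ae_restrict_of_subset (t := Set.Ioc 0 (0 + P)) (by
      rw [zero_add]; exact Set.Ioo_subset_Ioc_self) ?_
    filter_upwards [hpre, ae_restrict_mem measurableSet_Ioc] with t ht hmt
    have h1 : F (t : AddCircle P) = f t := AddCircle.liftIoc_coe_apply hmt
    rw [← h1]
    exact ht
  exact Measure.eqOn_Ioo_of_ae_eq _ hfae hf.continuousOn continuousOn_const

/-- Induction on the frequencies and on the degree of `g c`. The operator `d/dt - 2πc` replaces `g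
l` by `g l' + 2π(l - c) g l`, which lowers the degree of a nonzero `g c` and annihilates no nonzero
`g l` with `l ≠ c`. -/
theorem eq_zero_of_sum_eval_mul_exp_eq_zero {a b : ℝ} (hab : a < b) (s : Finset ℂ) :
    ∀ g : ℂ → ℂ[X], (∀ t ∈ Set.Ioo a b,
      ∑ l ∈ s, (g l).eval (t : ℂ) * Complex.exp (2 * Real.pi * l * t) = 0) →
      ∀ l ∈ s, g l = 0 := by
  have hpi : (2 * Real.pi : ℂ) ≠ 0 := by exact_mod_cast (by positivity : 2 * Real.pi ≠ 0)
  induction s using Finset.induction_on with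
  | empty => simp
  | insert c s hc ih =>
    have key : ∀ n : ℕ, ∀ g : ℂ → ℂ[X], (g c).degree < n → (∀ t ∈ Set.Ioo a b,
        ∑ l ∈ insert c s, (g l).eval (t : ℂ) * Complex.exp (2 * Real.pi * l * t) = 0) →
        ∀ l ∈ insert c s, g l = 0 := by
      intro n
      induction n with
      | zero =>
        intro g hg h l hl
        have hgc : g c = 0 := by simpa using hg
        rcases Finset.mem_insert.mp hl with rfl | hl
        · exact hgc
        refine ih g (fun t ht => ?_) l hl
        have := h t ht
        rwa [Finset.sum_insert hc, hgc, eval_zero, zero_mul, zero_add] at this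
      | succ n ihn =>
        intro g hg h
        have hD : ∀ l ∈ insert c s, derivative (g l) + C (2 * Real.pi * (l - c)) * g l = 0 := by
          refine ihn (fun l => derivative (g l) + C (2 * Real.pi * (l - c)) * g l) ?_ ?_
          · rw [sub_self, mul_zero, C_0, zero_mul, add_zero]
            rcases eq_or_ne (g c) 0 with h0 | h0
            · rw [h0, derivative_zero, degree_zero]
              exact WithBot.bot_lt_coe _
            · refine (degree_derivative_lt h0).trans_le ?_
              rw [degree_eq_natDegree h0] at hg ⊢
              have : (g c).natDegree < n + 1 := by exact_mod_cast hg
              exact_mod_cast Nat.lt_succ_iff.mp this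
          · intro t ht
            have hd1 : HasDerivAt (fun t : ℝ => ∑ l ∈ insert c s,
                (g l).eval (t : ℂ) * Complex.exp (2 * Real.pi * l * t))
                (∑ l ∈ insert c s, ((derivative (g l)).eval (t : ℂ)
                    * Complex.exp (2 * Real.pi * l * t)
                  + (g l).eval (t : ℂ) * (Complex.exp (2 * Real.pi * l * t)
                    * (2 * Real.pi * l * 1)))) t := by
              refine HasDerivAt.fun_sum fun l _ => ?_
              exact (((g l).hasDerivAt (t : ℂ)).mul
                ((hasDerivAt_id (t : ℂ)).const_mul (2 * Real.pi * l)).cexp).comp_ofReal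
            have hd2 : HasDerivAt (fun t : ℝ => ∑ l ∈ insert c s,
                (g l).eval (t : ℂ) * Complex.exp (2 * Real.pi * l * t)) 0 t := by
              refine (hasDerivAt_const t (0 : ℂ)).congr_of_eventuallyEq ?_
              filter_upwards [Ioo_mem_nhds ht.1 ht.2] with t ht using h t ht
            have h1 := hd1.unique hd2
            have h2 := h t ht
            have h3 : (∑ l ∈ insert c s, ((derivative (g l)).eval (t : ℂ)
                    * Complex.exp (2 * Real.pi * l * t)
                  + (g l).eval (t : ℂ) * (Complex.exp (2 * Real.pi * l * t)
                    * (2 * Real.pi * l * 1))))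
                - 2 * Real.pi * c * ∑ l ∈ insert c s, (g l).eval (t : ℂ)
                    * Complex.exp (2 * Real.pi * l * t) = 0 := by
              rw [h1, h2]
              ring
            rw [← h3, Finset.mul_sum, ← Finset.sum_sub_distrib]
            refine Finset.sum_congr rfl fun l _ => ?_
            simp only [eval_add, eval_mul, eval_C]
            ring
        have hs : ∀ l ∈ s, g l = 0 := by
          intro l hl
          by_contra h0
          have hne : (2 * Real.pi * (l - c) : ℂ) ≠ 0 :=
            mul_ne_zero hpi (sub_ne_zero.mpr fun h => hc (h ▸ hl))
          have h1 := eq_neg_of_add_eq_zero_left (hD l (Finset.mem_insert_of_mem hl))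
          have h2 := degree_derivative_lt h0
          rw [h1, degree_neg, degree_C_mul hne] at h2
          exact lt_irrefl _ h2
        -- Only the `c` term is left and `g c` is constant; any point of the interval, here the
        -- midpoint, shows that it is `0`.
        have hcc : g c = 0 := by
          have h1 := hD c (Finset.mem_insert_self c s)
          rw [sub_self, mul_zero, C_0, zero_mul, add_zero] at h1
          have h2 := h ((a + b) / 2) ⟨by linarith, by linarith⟩
          rw [Finset.sum_insert hc, Finset.sum_eq_zero (s := s), add_zero] at h2
          · have h3 := derivative_eq_zero.mp h1
            rw [eq_C_of_natDegree_eq_zero h3, eval_C] at h2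
            rw [eq_C_of_natDegree_eq_zero h3,
              (mul_eq_zero.mp h2).resolve_right (Complex.exp_ne_zero _), C_0]
          · intro l hl
            rw [hs l hl, eval_zero, zero_mul]
        intro l hl
        rcases Finset.mem_insert.mp hl with rfl | hl
        · exact hcc
        · exact hs l hl
    intro g h
    refine key ((g c).natDegree + 1) g ?_ h
    exact degree_le_natDegree.trans_lt (by exact_mod_cast Nat.lt_succ_self _)

namespace ExtExpSum

variable (y y' : ExtExpSum)

theorem continuous_toFun : Continuous y.toFun := by
  unfold toFun
  fun_prop

/-- The polynomial factor of `exp (2 π l t)`, which is `0` if `l` is not a frequency. -/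
def freqPoly (l : ℂ) : ℂ[X] := ∑ j, if y.lam j = l then y.coefPoly j else 0

theorem freqPoly_lam (j : Fin y.M) : y.freqPoly (y.lam j) = y.coefPoly j := by
  rw [freqPoly, Finset.sum_eq_single j]
  · simp
  · intro i _ hij
    exact if_neg fun h => hij (y.lam_injective h)
  · simp

theorem exists_lam_of_freqPoly_ne_zero {l : ℂ} (h : y.freqPoly l ≠ 0) : ∃ j, y.lam j = l := by
  by_contra! hne
  exact h (Finset.sum_eq_zero fun j _ => if_neg (hne j))

theorem toFun_eq_sum_freqPoly {s : Finset ℂ} (hs : ∀ j, y.lam j ∈ s) (t : ℝ) :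
    y.toFun t = ∑ l ∈ s, (y.freqPoly l).eval (t : ℂ) * Complex.exp (2 * Real.pi * l * t) := by
  simp only [freqPoly, eval_finsetSum, Finset.sum_mul]
  rw [Finset.sum_comm, toFun_eq]
  refine Finset.sum_congr rfl fun j _ => ?_
  rw [Finset.sum_eq_single_of_mem _ (hs j)]
  · rw [if_pos rfl]
  · intro l _ hl
    rw [if_neg hl.symm, eval_zero, zero_mul]

variable {y y'}

theorem sameParameters_of_freqPoly_eq (h : ∀ l, y.freqPoly l = y'.freqPoly l) :
    y.SameParameters y' := by
  have h1 : ∀ j, ∃ i, y'.lam i = y.lam j := fun j =>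
    y'.exists_lam_of_freqPoly_ne_zero (by
      rw [← h, freqPoly_lam]
      exact y.coefPoly_ne_zero j)
  have h2 : ∀ i, ∃ j, y.lam j = y'.lam i := fun i =>
    y.exists_lam_of_freqPoly_ne_zero (by
      rw [h, freqPoly_lam]
      exact y'.coefPoly_ne_zero i)
  choose e he using h1
  have hbij : Function.Bijective e := by
    constructor
    · intro i j hij
      apply y.lam_injective
      rw [← he i, ← he j, hij]
    · intro i
      obtain ⟨j, hj⟩ := h2 i
      exact ⟨j, y'.lam_injective ((he j).trans hj)⟩
  refine ⟨Equiv.ofBijective e hbij, fun j => ?_⟩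
  rw [Equiv.ofBijective_apply]
  have hpoly : y'.coefPoly (e j) = y.coefPoly j := by
    rw [← freqPoly_lam, ← freqPoly_lam, he, h]
  have hn : y'.n (e j) = y.n j := by
    rw [← natDegree_coefPoly, hpoly, natDegree_coefPoly]
  refine ⟨he j, hn, fun m hm => ?_⟩
  have hcoeff := congrArg (fun p => p.coeff m) hpoly
  simpa only [coeff_coefPoly, hn, if_pos hm] using hcoeff

theorem sameParameters_of_fourierCoef_eq {P : ℝ} (hP : 0 < P)
    (h : ∀ k, y'.fourierCoef P k = y.fourierCoef P k) : y.SameParameters y' := by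
  have hP' : (P : ℂ) ≠ 0 := by exact_mod_cast hP.ne'
  have hfun := eq_zero_of_fourierCoeff_eq_zero hP (y.continuous_toFun.sub y'.continuous_toFun)
    fun k => by
      have h1 := mul_left_cancel₀ (one_div_ne_zero hP') (h k)
      have hy := y.continuous_toFun
      have hy' := y'.continuous_toFun
      simp only [Pi.sub_apply, sub_mul]
      rw [intervalIntegral.integral_sub, h1, sub_self]
      · exact Continuous.intervalIntegrable (by fun_prop) _ _
      · exact Continuous.intervalIntegrable (by fun_prop) _ _
  set s : Finset ℂ := Finset.univ.image y.lam ∪ Finset.univ.image y'.lam with hs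
  have hy : ∀ j, y.lam j ∈ s := fun j =>
    Finset.mem_union_left _ (Finset.mem_image_of_mem _ (Finset.mem_univ j))
  have hy' : ∀ j, y'.lam j ∈ s := fun j =>
    Finset.mem_union_right _ (Finset.mem_image_of_mem _ (Finset.mem_univ j))
  have hzero := eq_zero_of_sum_eval_mul_exp_eq_zero hP s (fun l => y.freqPoly l - y'.freqPoly l)
    fun t ht => by
      simp only [eval_sub, sub_mul, Finset.sum_sub_distrib]
      rw [← y.toFun_eq_sum_freqPoly hy, ← y'.toFun_eq_sum_freqPoly hy']
      exact hfun t ht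
  refine sameParameters_of_freqPoly_eq fun l => ?_
  by_cases hl : l ∈ s
  · exact sub_eq_zero.mp (hzero l hl)
  · by_contra hne
    have h1 : y.freqPoly l = 0 := by
      by_contra h0
      obtain ⟨j, rfl⟩ := y.exists_lam_of_freqPoly_ne_zero h0
      exact hl (hy j)
    have h2 : y'.freqPoly l = 0 := by
      by_contra h0
      obtain ⟨j, rfl⟩ := y'.exists_lam_of_freqPoly_ne_zero h0
      exact hl (hy' j)
    exact hne (h1.trans h2.symm)

/-- Fourier coefficients on a sufficiently large index set containing `Σ` and `Σ'` determine all
Fourier coefficients. -/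
theorem fourierCoef_eq_of_eqOn {P : ℝ} (hP : P ≠ 0) {Γ : Finset ℤ}
    (hL : y.order + y'.order < Γ.card) (hΓ : y.periodicSet P ⊆ ↑Γ) (hΓ' : y'.periodicSet P ⊆ ↑Γ)
    (h : ∀ k ∈ Γ, y'.fourierCoef P k = y.fourierCoef P k) (k : ℤ) :
    y'.fourierCoef P k = y.fourierCoef P k := by
  by_cases hk : k ∈ Γ
  · exact h k hk
  obtain ⟨p, q, s, -, -, -, -, -, hd, hpd, hev, hout, -⟩ := y.exists_minimalSolution hP
  obtain ⟨p', q', s', -, -, -, -, -, hd', hpd', hev', hout', -⟩ := y'.exists_minimalSolution hP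
  -- This polynomial identity carries the agreement from `Γ` to all integers: for `k ∉ Γ` neither
  -- denominator vanishes, because `Σ` and `Σ'` lie in `Γ`.
  have hcross := mul_eq_mul_of_eval_eq Γ (y.fourierCoef P) (p * s) (q * s) (p' * s') (q' * s')
    y.order y'.order hL (natDegree_le_of_degree_le hpd.le) hd.le (natDegree_le_of_degree_le hpd'.le)
    hd'.le (fun k _ => hev k) fun k hk => by rw [hev', h k hk]
  have h1 := hout k fun hk' => hk (hΓ hk')
  have h2 := hout' k fun hk' => hk (hΓ' hk')
  have h3 := congrArg (fun u => u.eval (k : ℂ)) hcross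
  simp only [eval_mul] at h3
  rw [h1.2.2, h2.2.2] at h3
  have hne : q.eval (k : ℂ) * s.eval (k : ℂ) * (q'.eval (k : ℂ) * s'.eval (k : ℂ)) ≠ 0 :=
    mul_ne_zero (mul_ne_zero h1.1 h1.2.1) (mul_ne_zero h2.1 h2.2.1)
  exact mul_right_cancel₀ hne (by linear_combination -h3)

end ExtExpSum

end

theorem mainTheorem1 (P : ℝ) (hP : 0 < P) (y : ExtExpSum) (hM₂ : 0 < y.numPeriodic P)
    (Γ : Finset ℤ) (hL : 2 * y.order + 2 ≤ Γ.card) (hΓ : y.periodicSet P ⊆ ↑Γ) :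
    -- unique recovery of `y`, among all admissible sums for `Γ`
    (∀ y' : ExtExpSum, 2 * y'.order + 2 ≤ Γ.card → y'.periodicSet P ⊆ ↑Γ →
      (∀ k ∈ Γ, y'.fourierCoef P k = y.fourierCoef P k) → y.SameParameters y') ∧
    -- the algorithm, for all sufficiently small tolerances
    (∃ tol₀ : ℝ, 0 < tol₀ ∧ ∀ tol : ℝ, 0 < tol → tol ≤ tol₀ → ∀ jmax : ℕ, y.order + 1 ≤ jmax →
      -- it can start
      (∃ S w, (fourierInput y P Γ tol jmax).Reaches 1 S w) ∧
      -- every run stops after at most `N + 1` steps, and can be continued until it stops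
      (∀ j S w, (fourierInput y P Γ tol jmax).Reaches j S w →
        j ≤ y.order + 1 ∧
        ((fourierInput y P Γ tol jmax).Stops S w ∨
          (fourierInput y P Γ tol jmax).CanContinue j S w)) ∧
      -- every result is of the stated type and represents all `c_k(y)`, `k ∉ Σ`
      (∀ j S w, (fourierInput y P Γ tol jmax).Reaches j S w →
        (fourierInput y P Γ tol jmax).Stops S w →
        IsOfType ((fourierInput y P Γ tol jmax).ratFunc S w) (y.order - y.numPeriodic P) ∧
        ∀ k : ℤ, k ∉ y.periodicSet P →
          ((fourierInput y P Γ tol jmax).ratFunc S w).denom.eval (k : ℂ) ≠ 0 ∧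
          ((fourierInput y P Γ tol jmax).ratFunc S w).eval (RingHom.id ℂ) (k : ℂ)
            = y.fourierCoef P k)) := by
  have hN : 1 ≤ y.order := le_trans hM₂ (y.numPeriodic_le_order P)
  refine ⟨fun y' hL' hΓ' h => ExtExpSum.sameParameters_of_fourierCoef_eq hP
    (ExtExpSum.fourierCoef_eq_of_eqOn hP.ne' (by omega) hΓ hΓ' h), ?_⟩
  obtain ⟨p, q, s, hq, hqd, hpd, hcop, hs, hd, hpsd, hev, hout, hdvd⟩ :=
    y.exists_minimalSolution hP.ne'
  have hm := y.isMinimalSolution (by omega) hΓ hq hcop hs hd hpsd hev hdvd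
  have hx : Function.Injective fun k : ℤ => (k : ℂ) := Int.cast_injective
  -- The values `1` and `0` are placeholders: the bound depends only on the points, the data and
  -- `Γ`.
  obtain ⟨tol₀, htol₀, hns⟩ :=
    AAAInput.exists_pos_not_stops (I := fourierInput y P Γ 1 0) hx (hm 1 0)
  refine ⟨tol₀, htol₀, fun tol htol hle jmax hjmax => ⟨?_, fun j S w hr => ?_,
    fun j S w hr hstops => ?_⟩⟩
  · refine AAAInput.exists_reaches_one (I := fourierInput y P Γ tol jmax) ?_ ?_
    · exact le_trans (by omega) hL
    · exact le_trans (by omega) hjmax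
  · obtain ⟨-, -, hj, -⟩ := hr.support hx (hm tol jmax) hN htol
    refine ⟨by omega, or_iff_not_imp_left.mpr fun hfail => ?_⟩
    exact hr.canContinue hx (hm tol jmax) hN htol hjmax (lt_of_lt_of_le (by omega) hL) hfail
  -- Cancelling `s` leaves the coprime pair `p`, `q`, which lowers the denominator degree from `N`
  -- to `N - M₂`.
  · rw [hr.ratFunc_eq hx (hm tol jmax) hN htol (hns tol htol hle jmax) hstops, map_mul, map_mul,
      mul_div_mul_right _ _ (RatFunc.algebraMap_ne_zero hs.ne_zero)]
    obtain ⟨hnum, hden⟩ := RatFunc.num_denom_of_isCoprime hq hcop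
    refine ⟨⟨by rwa [hnum], by rw [hden, hqd]⟩, fun k hk => ?_⟩
    obtain ⟨h1, -, h2⟩ := hout k hk
    refine ⟨by rwa [hden], ?_⟩
    rw [RatFunc.eval, hnum, hden, Polynomial.eval₂_id, Polynomial.eval₂_id, h2,
      mul_div_cancel_right₀ _ h1]
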